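/- Let $a<b$ be real, let $\nu=\lambda+i\mu\in\mathbb C$ with $\lambda,\mu\in\mathbb R$, and for $j\ge 0$ put $$B_j(x,y)=\sum_{n\ge0}\frac{(-1)^{n+j}x^{n+j}y^n}{(n+j)!\,n!}\qquad\Big(=(-1)^j(x/y)^{j/2}J_j(2\sqrt{xy})\ \text{ for }x,y>0\Big).$$ For $N\ge1$ let $\Delta=(b-a)/N$ and $x_j=a+j\Delta$ ($0\le j\le N$), and let $\chi_j=\Delta^{-1/2}\,1_{[x_{j-1},x_j)}$ ($1\le j\le N$) be the normalized indicator functions in $L^2([a,b))$. For $j<k$ let $R^N_{j,k}$ be the $N\times N$ matrix that agrees with the identity except for the entries $\cos(\Delta|\nu|)$ at $(j,j)$ and $(k,k)$, $-\frac{\bar\nu}{|\nu|}\sin(\Delta|\nu|)$ at $(j,k)$ and $\frac{\nu}{|\nu|}\sin(\Delta|\nu|)$ at $(k,j)$ (with $R^N_{j,k}=I$ if $\nu=0$), and let $Z^N(j,k)=-\bar\nu|\chi_j\rangle\langle\chi_k|+\nu|\chi_k\rangle\langle\chi_j|$. Let $$\mathcal W_N=\prod_{1\le j<k\le N}R^N_{j,k},\qquad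 W_N=\prod_{1\le j<k\le N}\big(I+\Delta\,Z^N(j,k)\big),$$ where $\prod_{1\le j<k\le N}=\prod_{j=1}^{N-1}\prod_{k=j+1}^{N}$ with factors ordered from left to right, and where matrices act on the span of $\chi_1,\dots,\chi_N$ in this basis and as the identity on its orthogonal complement in $L^2([a,b))$. Then, as $N\to\infty$, $\mathcal W_N$ and $W_N$ converge in the weak operator topology to one and the same bounded operator $W$ on $L^2([a,b))$; $W-I$ is the integral operator $f\mapsto\int_a^b K(\cdot,y)f(y)\,dy$ with kernel $$K(x,y)=\begin{cases}\nu B_0\big((y-a)|\nu|,(b-x)|\nu|\big)+|\nu|B_1\big((b-a)|\nu|,(y-x)|\nu|\big)\\[2pt]\quad{}-(\nu+\bar\nu)\displaystyle\sum_{q\ge0}B_q\big((y-x)|\nu|,(b-a)|\nu|\big)\Big(\frac{\bar\nu}{|\nu|}\Big)^q,& a\le x<y<b,\\[8pt]\nu B_0\big((y-a)|\nu|,(b-x)|\nu|\big),& a\le y<x<b,\end{cases}$$ and $K(x,x)=0$ (for $\nu=0$ the kernel is $0$); and $W$ is unitary. -/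

import Mathlib

open MeasureTheory Filter Topology

namespace CausalProduct

noncomputable section

/-! ### The Bessel-type functions and the kernel -/

/-- The `n`-th term `(-1)^(n+j) x^(n+j) y^n / ((n+j)! n!)` of the power series of `B_j`. -/
def besselBTerm (j : ℕ) (x y : ℝ) (n : ℕ) : ℝ :=
  (-1) ^ (n + j) * x ^ (n + j) * y ^ n / ((n + j).factorial * n.factorial)

/-- `B_j(x, y) = ∑_{n ≥ 0} (-1)^(n+j) x^(n+j) y^n / ((n+j)! n!)`. -/
def besselB (j : ℕ) (x y : ℝ) : ℝ := ∑' n : ℕ, besselBTerm j x y n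

theorem norm_besselBTerm_le (j : ℕ) (x y : ℝ) (n : ℕ) :
    ‖besselBTerm j x y n‖ ≤ (|x| ^ j / j.factorial) * ((|x| * |y|) ^ n / n.factorial) := by
  have h1 : ‖besselBTerm j x y n‖
      = |x| ^ (n + j) * |y| ^ n / ((n + j).factorial * n.factorial) := by
    simp [besselBTerm]
  have hj : (j.factorial : ℝ) ≤ (n + j).factorial := by
    exact_mod_cast Nat.factorial_le (Nat.le_add_left j n)
  have hj0 : (0 : ℝ) < j.factorial := by exact_mod_cast j.factorial_pos
  have hn0 : (0 : ℝ) < n.factorial := by exact_mod_cast n.factorial_pos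
  have h2 : (|x| ^ j / j.factorial) * ((|x| * |y|) ^ n / n.factorial)
      = |x| ^ (n + j) * |y| ^ n / (j.factorial * n.factorial) := by
    rw [div_mul_div_comm, mul_pow, pow_add]; ring
  rw [h1, h2]
  gcongr

/-- The series of `B_j(x, y)` converges absolutely for all real `x, y`. -/
theorem summable_besselBTerm (j : ℕ) (x y : ℝ) : Summable (besselBTerm j x y) :=
  Summable.of_norm_bounded ((Real.summable_pow_div_factorial (|x| * |y|)).mul_left _)
    (norm_besselBTerm_le j x y)

theorem abs_besselB_le (j : ℕ) (x y : ℝ) :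
    |besselB j x y| ≤ (|x| ^ j / j.factorial) * ∑' n : ℕ, (|x| * |y|) ^ n / n.factorial := by
  have hs := Real.summable_pow_div_factorial (|x| * |y|)
  rw [← tsum_mul_left]
  exact tsum_of_norm_bounded (hs.mul_left _).hasSum (norm_besselBTerm_le j x y)

/-- The Bessel function of the first kind `J_j` of integer order `j ≥ 0`. -/
def besselJ (j : ℕ) (t : ℝ) : ℝ :=
  ∑' n : ℕ, (-1) ^ n / ((n.factorial : ℝ) * (n + j).factorial) * (t / 2) ^ (2 * n + j)

/-- For `x, y > 0`, `B_j(x, y) = (-1)^j (x/y)^(j/2) J_j(2 √(xy))`. -/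
theorem besselB_eq_besselJ (j : ℕ) {x y : ℝ} (hx : 0 < x) (hy : 0 < y) :
    besselB j x y = (-1) ^ j * (x / y) ^ ((j : ℝ) / 2) * besselJ j (2 * √(x * y)) := by
  have hr : (x / y) ^ ((j : ℝ) / 2) = (√x / √y) ^ j := by
    rw [← Real.sqrt_div hx.le, Real.sqrt_eq_rpow, ← Real.rpow_natCast, ← Real.rpow_mul (by positivity)]
    congr 1; ring
  rw [besselB, besselJ, ← tsum_mul_left, hr]
  refine tsum_congr fun n => ?_
  have hx' : √x ^ 2 = x := Real.sq_sqrt hx.le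
  have hy' : √y ^ 2 = y := Real.sq_sqrt hy.le
  have hy0 : √y ≠ 0 := (Real.sqrt_pos.2 hy).ne'
  have key : (√x / √y) ^ j * (√x * √y) ^ (2 * n + j) = x ^ (n + j) * y ^ n := by
    rw [div_pow, mul_pow, ← hx', ← hy']
    simp only [Real.sqrt_sq (Real.sqrt_nonneg _)]
    field_simp
    ring
  rw [Real.sqrt_mul hx.le, mul_div_cancel_left₀ _ (two_ne_zero), besselBTerm]
  calc _ = (-1) ^ (n + j) * (x ^ (n + j) * y ^ n) / ((n + j).factorial * n.factorial) := by ring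
    _ = _ := by rw [← key]; ring

/-- The part of the kernel on `a ≤ x < y < b`. -/
def kernelUpper (a b : ℝ) (ν : ℂ) (x y : ℝ) : ℂ :=
  ν * besselB 0 ((y - a) * ‖ν‖) ((b - x) * ‖ν‖)
    + ‖ν‖ * besselB 1 ((b - a) * ‖ν‖) ((y - x) * ‖ν‖)
    - (ν + star ν) *
      ∑' q : ℕ, (besselB q ((y - x) * ‖ν‖) ((b - a) * ‖ν‖) : ℂ) * (star ν / ‖ν‖) ^ q

/-- The series over `q` in the kernel converges absolutely. -/
theorem summable_kernelUpper (a b : ℝ) (ν : ℂ) (x y : ℝ) :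
    Summable fun q : ℕ =>
      (besselB q ((y - x) * ‖ν‖) ((b - a) * ‖ν‖) : ℂ) * (star ν / ‖ν‖) ^ q := by
  set s := (y - x) * ‖ν‖
  set t := (b - a) * ‖ν‖
  refine Summable.of_norm_bounded ((Real.summable_pow_div_factorial |s|).mul_right
    (∑' n : ℕ, (|s| * |t|) ^ n / n.factorial)) fun q => ?_
  have hu : ‖(star ν / ‖ν‖ : ℂ) ^ q‖ ≤ 1 := by
    rw [norm_pow]
    refine pow_le_one₀ (norm_nonneg _) ?_
    rw [norm_div, norm_star, Complex.norm_real, norm_norm]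
    exact div_self_le_one _
  rw [norm_mul, Complex.norm_real]
  calc _ ≤ ‖besselB q s t‖ * 1 := by gcongr
    _ ≤ _ := by rw [mul_one]; exact abs_besselB_le q s t

/-- The part of the kernel on `a ≤ y < x < b`. -/
def kernelLower (a b : ℝ) (ν : ℂ) (x y : ℝ) : ℂ :=
  ν * besselB 0 ((y - a) * ‖ν‖) ((b - x) * ‖ν‖)

open Classical in
/-- The kernel of `W - I`: `kernelUpper` times the indicator of `a ≤ x < y < b`, plus
`kernelLower` times the indicator of `a ≤ y < x < b`. -/
def kernel (a b : ℝ) (ν : ℂ) (x y : ℝ) : ℂ :=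
  (if a ≤ x ∧ x < y ∧ y < b then kernelUpper a b ν x y else 0)
    + (if a ≤ y ∧ y < x ∧ x < b then kernelLower a b ν x y else 0)

/-! ### The Hilbert space `L²([a, b))`, weak limits, integral operators -/

/-- Lebesgue measure on `[a, b)`. -/
abbrev vol (a b : ℝ) : Measure ℝ := volume.restrict (Set.Ico a b)

/-- The complex Hilbert space `L²([a, b))`. -/
abbrev H (a b : ℝ) : Type := Lp ℂ 2 (vol a b)

/-- Convergence of a sequence of bounded operators in the weak operator topology. -/
def TendstoWeakly {a b : ℝ} (T : ℕ → H a b →L[ℂ] H a b) (W : H a b →L[ℂ] H a b) : Prop :=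
  ∀ f g : H a b, Tendsto (fun N => inner ℂ f (T N g)) atTop (𝓝 (inner ℂ f (W g)))

/-- `T` is the integral operator with kernel `K`: for every `f` and almost every `x`, the function
`y ↦ K x y * f y` is integrable and its integral is `(T f) x`. -/
def IsIntegralOperator {a b : ℝ} (T : H a b →L[ℂ] H a b) (K : ℝ → ℝ → ℂ) : Prop :=
  ∀ f : H a b, ∀ᵐ x ∂(vol a b),
    Integrable (fun y => K x y * f y) (vol a b) ∧ T f x = ∫ y, K x y * f y ∂(vol a b)

/-! ### The discrete double products -/

/-- The mesh `(b - a) / N`. -/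
def mesh (a b : ℝ) (N : ℕ) : ℝ := (b - a) / N

/-- The normalized indicator functions of the intervals of the equipartition of `[a, b)` into `N`
intervals. The index set is `{0, …, N - 1}`, and `χ_j` lives on `[a + jΔ, a + (j + 1)Δ)`. -/
def chi (a b : ℝ) (N : ℕ) (j : Fin N) : H a b :=
  indicatorConstLp 2
    (measurableSet_Ico (a := a + (j : ℕ) * mesh a b N) (b := a + ((j : ℕ) + 1) * mesh a b N))
    (measure_ne_top (vol a b) _) ((√(N / (b - a)) : ℝ) : ℂ)

/-- The `N × N` matrix `M` as an operator on `L²([a, b))`: it acts as `M` on the span of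
`χ_0, …, χ_{N-1}` in this orthonormal family, and as the identity on the orthogonal complement. -/
def embed (a b : ℝ) (N : ℕ) (M : Matrix (Fin N) (Fin N) ℂ) : H a b →L[ℂ] H a b :=
  1 + ∑ j : Fin N, ∑ k : Fin N,
    (M - 1) j k • InnerProductSpace.rankOne ℂ (chi a b N j) (chi a b N k)

/-- The ordered double product `∏_{j < k} R j k`, i.e. `∏_j ∏_{k > j} R j k`, where in each product
the factors with smaller index stand to the left. -/
def orderedProd {N : ℕ} (R : Fin N → Fin N → Matrix (Fin N) (Fin N) ℂ) :
    Matrix (Fin N) (Fin N) ℂ :=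
  ((List.finRange N).map fun j =>
    (((List.finRange N).filter fun k => j < k).map fun k => R j k).prod).prod

/-- The matrix `R_{j,k}` (`j ≠ k`) of the rotation-like operator in the `(j, k)`-plane:
the identity matrix except for the entries `cos (Δ|ν|)` at `(j, j)` and `(k, k)`,
`-(ν̄/|ν|) sin (Δ|ν|)` at `(j, k)` and `(ν/|ν|) sin (Δ|ν|)` at `(k, j)`. -/
def rotation (a b : ℝ) (ν : ℂ) (N : ℕ) (j k : Fin N) : Matrix (Fin N) (Fin N) ℂ :=
  1 + ((Real.cos (mesh a b N * ‖ν‖) : ℂ) - 1) • (Matrix.single j j 1 + Matrix.single k k 1)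
    - (star ν / ‖ν‖ * Real.sin (mesh a b N * ‖ν‖)) • Matrix.single j k 1
    + (ν / ‖ν‖ * Real.sin (mesh a b N * ‖ν‖)) • Matrix.single k j 1

/-- The first-order factor `I + Δ Z(j, k)`, where `Z(j, k) = -ν̄ |j⟩⟨k| + ν |k⟩⟨j|`. -/
def linearized (a b : ℝ) (ν : ℂ) (N : ℕ) (j k : Fin N) : Matrix (Fin N) (Fin N) ℂ :=
  1 + (mesh a b N : ℂ) • (-(star ν) • Matrix.single j k 1 + ν • Matrix.single k j 1)

/-- The double product of the rotations, as an operator on `L²([a, b))`. -/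
def rotationProduct (a b : ℝ) (ν : ℂ) (N : ℕ) : H a b →L[ℂ] H a b :=
  embed a b N (orderedProd (rotation a b ν N))

/-- The double product `W_N` of the factors `I + Δ Z(j, k)`, as an operator on `L²([a, b))`. -/
def linearizedProduct (a b : ℝ) (ν : ℂ) (N : ℕ) : H a b →L[ℂ] H a b :=
  embed a b N (orderedProd (linearized a b ν N))

end

end CausalProduct

namespace CausalProduct

noncomputable section

/-! ### Calculus of the Bessel-type functions -/

/-! Multiplying a row vector by the factors from left to right, the factor (j, k) changes only
positions j and k. So the row started at the i-th unit vector is described by two grid functions: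
`stage` j k, the value at k before the factors with first index j, and `sweep` j k, the value at j
after the factor (j, k). They obey sweep(j, k+1) = c sweep(j, k) + α stage(j, k+1) and stage(j+1, k)
= c stage(j, k) - β sweep(j, k-1), where for both products c = 1 + O(Δ²), α = νΔ + O(Δ²), β = ν̄Δ +
O(Δ²). Divided by Δ, this is a difference scheme for the Goursat system ∂_Z P = νV, ∂_X V = -ν̄P
with X = jΔ, Z = kΔ. Entry (i, j) of the product is the final value of sweep j, hence about Δ P(jΔ,
b - a) off the diagonal.

Put X₀ = iΔ. For X < X₀ the unit vector imposes P = ν on Z = X₀ and V = 0 on X = 0; the solution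
`lowerP`, `lowerV` consists of B_0 and B_1 and gives the kernel below the diagonal. During sweep i
the value is close to 1 instead of O(Δ): this is the diagonal entry, and it makes V jump by -ν̄. For
X > X₀ the solution restarts from the shifted V with P = V on the diagonal; the added part is
`upperP`, `upperV`. Local defects are O(Δ³), and a Gronwall estimate in each direction
(`goursat_error_le`) keeps the error O(Δ²) (`exists_entry_bound`).

Consequently the step kernels of both products are bounded and converge to the kernel off the
diagonal, a null set. Dominated convergence gives Hilbert-Schmidt convergence of the differences, so
the operators converge in norm (`ApproximatesKernel.tendsto_embed`). This is more than weak
convergence, and it is what carries unitarity of the rotation products over to the limit. -/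

theorem summable_of_succ {u : ℕ → ℝ} (h : Summable fun n => u (n + 1)) : Summable u :=
  (summable_nat_add_iff 1).1 h

theorem tsum_pow_div_factorial (x : ℝ) : ∑' n : ℕ, x ^ n / n.factorial = Real.exp x := by
  rw [Real.exp_eq_exp_ℝ, NormedSpace.exp_eq_tsum_div]

theorem abs_besselB_le_of_le {R s t : ℝ} (hs : |s| ≤ R) (ht : |t| ≤ R) (j : ℕ) :
    |besselB j s t| ≤ R ^ j / j.factorial * Real.exp (R * R) := by
  refine (abs_besselB_le j s t).trans ?_
  rw [tsum_pow_div_factorial]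
  have : 0 ≤ R := (abs_nonneg s).trans hs
  gcongr

/-- A bound for the Bessel-type functions and their sums on the square `[-R, R]²`. -/
def boxBound (R : ℝ) : ℝ := Real.exp R * Real.exp (R * R)

theorem boxBound_pos (R : ℝ) : 0 < boxBound R := by unfold boxBound; positivity

theorem abs_besselB_le_boxBound {R s t : ℝ} (hs : |s| ≤ R) (ht : |t| ≤ R) (j : ℕ) :
    |besselB j s t| ≤ boxBound R := by
  refine (abs_besselB_le_of_le hs ht j).trans ?_
  have : 0 ≤ R := (abs_nonneg s).trans hs
  unfold boxBound
  gcongr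
  exact Real.pow_div_factorial_le_exp R this j

theorem besselB_zero_comm (s t : ℝ) : besselB 0 s t = besselB 0 t s := by
  unfold besselB besselBTerm
  refine tsum_congr fun n => ?_
  simp only [add_zero]
  ring

/-- Termwise differentiation in t turns the term n + 1 of B_j into the term n of B_{j+1}; the
derivative series is dominated by an exponential series on a ball around 0 containing t. -/
theorem hasDerivAt_besselB_right (j : ℕ) (s t : ℝ) :
    HasDerivAt (fun t => besselB j s t) (besselB (j + 1) s t) t := by
  set g' : ℕ → ℝ → ℝ := fun n y => Nat.casesOn n 0 fun m => besselBTerm (j + 1) s y m with hg'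
  set R : ℝ := |t| + 1
  set u : ℕ → ℝ := fun n => Nat.casesOn n 0 fun m =>
    (|s| ^ (j + 1) / (j + 1).factorial) * ((|s| * R) ^ m / m.factorial) with hu
  have husum : Summable u :=
    summable_of_succ ((Real.summable_pow_div_factorial (|s| * R)).mul_left _)
  have hd : ∀ n y, y ∈ Metric.ball (0 : ℝ) R →
      HasDerivAt (fun t => besselBTerm j s t n) (g' n y) y := by
    intro n y _
    cases n with
    | zero => simpa [besselBTerm, hg'] using hasDerivAt_const y _
    | succ m =>
      have h := (((hasDerivAt_pow (m + 1) y).const_mul ((-1) ^ (m + 1 + j) * s ^ (m + 1 + j)))).div_const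
        (((m + 1 + j).factorial : ℝ) * (m + 1).factorial)
      refine h.congr_deriv ?_
      have h1 : ((m + 1).factorial : ℝ) = (m + 1) * m.factorial := by
        push_cast [Nat.factorial_succ]; ring
      have h2 : m + 1 + j = m + (j + 1) := by ring
      have h3 : ((m + (j + 1)).factorial : ℝ) ≠ 0 := by positivity
      simp only [hg', besselBTerm, h1, h2, Nat.add_sub_cancel, Nat.cast_add, Nat.cast_one]
      field_simp
  have hb : ∀ n y, y ∈ Metric.ball (0 : ℝ) R → ‖g' n y‖ ≤ u n := by
    intro n y hy
    cases n with
    | zero => simp [hg', hu]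
    | succ m =>
      refine (norm_besselBTerm_le (j + 1) s y m).trans ?_
      have : |y| ≤ R := by simpa using (Metric.mem_ball.1 hy).le
      simp only [hu]
      gcongr
  have ht : t ∈ Metric.ball (0 : ℝ) R := by simp [R]
  have := hasDerivAt_tsum_of_isPreconnected husum Metric.isOpen_ball
    (convex_ball (0 : ℝ) R).isPreconnected hd hb ht (summable_besselBTerm j s t) ht
  refine this.congr_deriv ?_
  -- The term n = 0 is constant in t, so the derivative series starts one index later.
  rw [Summable.tsum_eq_zero_add (Summable.of_norm_bounded husum fun n => hb n t ht)]
  simp [hg', besselB]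

theorem hasDerivAt_besselB_succ_left (j : ℕ) (s t : ℝ) :
    HasDerivAt (fun s => besselB (j + 1) s t) (-besselB j s t) s := by
  set R : ℝ := |s| + 1
  have hd : ∀ n y, y ∈ Metric.ball (0 : ℝ) R →
      HasDerivAt (fun s => besselBTerm (j + 1) s t n) (-besselBTerm j y t n) y := by
    intro n y _
    have h := (((hasDerivAt_pow (n + (j + 1)) y).const_mul ((-1) ^ (n + (j + 1)))).mul_const
      (t ^ n)).div_const (((n + (j + 1)).factorial : ℝ) * n.factorial)
    refine h.congr_deriv ?_
    have h1 : ((n + (j + 1)).factorial : ℝ) = (n + j + 1) * (n + j).factorial := by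
      rw [← add_assoc]; push_cast [Nat.factorial_succ]; ring
    have h3 : (n + j + 1 : ℝ) ≠ 0 := by positivity
    have h4 : n + (j + 1) - 1 = n + j := by omega
    simp only [besselBTerm, h1, h4]
    rw [← add_assoc, pow_succ]
    push_cast
    field_simp
  have hb : ∀ n y, y ∈ Metric.ball (0 : ℝ) R → ‖-besselBTerm j y t n‖
      ≤ R ^ j / j.factorial * ((R * |t|) ^ n / n.factorial) := by
    intro n y hy
    rw [norm_neg]
    refine (norm_besselBTerm_le j y t n).trans ?_
    have : |y| ≤ R := by simpa using (Metric.mem_ball.1 hy).le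
    gcongr
  have hs : s ∈ Metric.ball (0 : ℝ) R := by simp [R]
  have := hasDerivAt_tsum_of_isPreconnected
    ((Real.summable_pow_div_factorial (R * |t|)).mul_left (R ^ j / j.factorial)) Metric.isOpen_ball
    (convex_ball (0 : ℝ) R).isPreconnected hd hb hs (summable_besselBTerm (j + 1) s t) hs
  refine this.congr_deriv ?_
  rw [tsum_neg, besselB]

theorem hasDerivAt_besselB_zero_left (s t : ℝ) :
    HasDerivAt (fun s => besselB 0 s t) (besselB 1 t s) s := by
  simp_rw [fun s => besselB_zero_comm s t]
  exact hasDerivAt_besselB_right 0 t s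

/-- The sum `∑_q B_{q+k}(s, t) ω^q`. -/
def besselSum (k : ℕ) (ω : ℂ) (s t : ℝ) : ℂ := ∑' q : ℕ, (besselB (q + k) s t : ℂ) * ω ^ q

theorem norm_besselSum_term_le {R s t : ℝ} {ω : ℂ} (hω : ‖ω‖ ≤ 1) (hs : |s| ≤ R) (ht : |t| ≤ R)
    (k q : ℕ) : ‖(besselB (q + k) s t : ℂ) * ω ^ q‖
      ≤ R ^ (q + k) / (q + k).factorial * Real.exp (R * R) := by
  rw [norm_mul, norm_pow, Complex.norm_real, Real.norm_eq_abs]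
  have h := abs_besselB_le_of_le hs ht (q + k)
  have h1 : ‖ω‖ ^ q ≤ 1 := pow_le_one₀ (norm_nonneg _) hω
  calc _ ≤ |besselB (q + k) s t| * 1 := by gcongr
    _ ≤ _ := by rwa [mul_one]

theorem summable_pow_div_factorial_shift (R : ℝ) (k : ℕ) :
    Summable fun q : ℕ => R ^ (q + k) / (q + k).factorial * Real.exp (R * R) :=
  (((summable_nat_add_iff k).2 (Real.summable_pow_div_factorial R)).mul_right _)

theorem summable_besselSum {ω : ℂ} (hω : ‖ω‖ ≤ 1) (k : ℕ) (s t : ℝ) :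
    Summable fun q : ℕ => (besselB (q + k) s t : ℂ) * ω ^ q :=
  Summable.of_norm_bounded (summable_pow_div_factorial_shift (max |s| |t|) k)
    fun q => norm_besselSum_term_le hω (le_max_left _ _) (le_max_right _ _) k q

theorem norm_besselSum_le {R s t : ℝ} {ω : ℂ} (hω : ‖ω‖ ≤ 1) (hs : |s| ≤ R) (ht : |t| ≤ R)
    (k : ℕ) : ‖besselSum k ω s t‖ ≤ boxBound R := by
  have hR : 0 ≤ R := (abs_nonneg s).trans hs
  refine (tsum_of_norm_bounded (summable_pow_div_factorial_shift R k).hasSum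
    fun q => norm_besselSum_term_le hω hs ht k q).trans ?_
  -- The bound is a tail of the exponential series of R, hence at most the full series.
  rw [tsum_mul_right, boxBound, ← tsum_pow_div_factorial R,
    ← (Real.summable_pow_div_factorial R).sum_add_tsum_nat_add k]
  gcongr
  refine le_add_of_nonneg_left (Finset.sum_nonneg fun i _ => by positivity)

theorem hasDerivAt_besselSum_right {ω : ℂ} (hω : ‖ω‖ ≤ 1) (k : ℕ) (s t : ℝ) :
    HasDerivAt (fun t => besselSum k ω s t) (besselSum (k + 1) ω s t) t := by
  set R : ℝ := max |s| (|t| + 1)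
  have ht : t ∈ Metric.ball (0 : ℝ) R := by simp [R]
  refine hasDerivAt_tsum_of_isPreconnected (summable_pow_div_factorial_shift R (k + 1))
    Metric.isOpen_ball (convex_ball (0 : ℝ) R).isPreconnected
    (g' := fun q y => (besselB (q + (k + 1)) s y : ℂ) * ω ^ q) ?_ ?_ ht
    (summable_besselSum hω k s t) ht
  · intro q y _
    exact ((hasDerivAt_besselB_right (q + k) s y).ofReal_comp).mul_const _
  · intro q y hy
    exact norm_besselSum_term_le hω (le_max_left _ _) (mem_ball_zero_iff.1 hy).le _ q

theorem hasDerivAt_besselSum_succ_left {ω : ℂ} (hω : ‖ω‖ ≤ 1) (k : ℕ) (s t : ℝ) :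
    HasDerivAt (fun s => besselSum (k + 1) ω s t) (-besselSum k ω s t) s := by
  set R : ℝ := max (|s| + 1) |t|
  have hs : s ∈ Metric.ball (0 : ℝ) R := by simp [R]
  have := hasDerivAt_tsum_of_isPreconnected (summable_pow_div_factorial_shift R k)
    Metric.isOpen_ball (convex_ball (0 : ℝ) R).isPreconnected
    (g := fun q y => (besselB (q + (k + 1)) y t : ℂ) * ω ^ q)
    (g' := fun q y => -((besselB (q + k) y t : ℂ) * ω ^ q)) ?_ ?_ hs
    (summable_besselSum hω (k + 1) s t) hs
  · refine this.congr_deriv ?_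
    rw [tsum_neg, besselSum]
  · intro q y _
    refine (((hasDerivAt_besselB_succ_left (q + k) y t).ofReal_comp).mul_const _).congr_deriv ?_
    push_cast; ring
  · intro q y hy
    rw [norm_neg]
    exact norm_besselSum_term_le hω (mem_ball_zero_iff.1 hy).le (le_max_right _ _) _ q

/-- The left derivative lowers the index by one, which is impossible at index 0; splitting off q = 0
leaves a sum that can be differentiated. The same identity matches the data on the diagonal in
`lower_add_upper_diag`. -/
theorem besselSum_zero_eq {ω : ℂ} (hω : ‖ω‖ ≤ 1) (s t : ℝ) :
    besselSum 0 ω s t = besselB 0 s t + ω * besselSum 1 ω s t := by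
  rw [besselSum, (summable_besselSum hω 0 s t).tsum_eq_zero_add, besselSum, ← tsum_mul_left]
  simp only [add_zero, pow_zero, mul_one]
  congr 1
  refine tsum_congr fun q => ?_
  ring

theorem hasDerivAt_besselSum_zero_left {ω : ℂ} (hω : ‖ω‖ ≤ 1) (s t : ℝ) :
    HasDerivAt (fun s => besselSum 0 ω s t) (besselB 1 t s - ω * besselSum 0 ω s t) s := by
  simp_rw [fun s => besselSum_zero_eq hω s t]
  refine ((hasDerivAt_besselB_zero_left s t).ofReal_comp.add
    ((hasDerivAt_besselSum_succ_left hω 0 s t).const_mul ω)).congr_deriv ?_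
  rw [besselSum_zero_eq hω s t]; ring

theorem besselB_zero_zero_left (t : ℝ) : besselB 0 0 t = 1 := by
  rw [besselB, tsum_eq_single 0]
  · simp [besselBTerm]
  · intro n hn; simp [besselBTerm, hn]

theorem besselB_zero_zero_right (s : ℝ) : besselB 0 s 0 = 1 := by
  rw [besselB_zero_comm, besselB_zero_zero_left]

theorem besselB_succ_zero_left (j : ℕ) (t : ℝ) : besselB (j + 1) 0 t = 0 := by
  simp [besselB, besselBTerm]

theorem besselSum_succ_zero_left (k : ℕ) (ω : ℂ) (t : ℝ) : besselSum (k + 1) ω 0 t = 0 := by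
  simp [besselSum, ← add_assoc, besselB_succ_zero_left]

/-! ### Lipschitz bounds on squares -/

/-- `f` is bounded by `L` on the square `[-R, R]²` and Lipschitz there with constant `L` for the
`ℓ¹` distance. -/
def LipOnBox (R L : ℝ) (f : ℝ → ℝ → ℂ) : Prop :=
  (∀ s t, |s| ≤ R → |t| ≤ R → ‖f s t‖ ≤ L) ∧
  ∀ s t s' t', |s| ≤ R → |t| ≤ R → |s'| ≤ R → |t'| ≤ R →
    ‖f s t - f s' t'‖ ≤ L * (|s - s'| + |t - t'|)

/-- The mean value inequality is applied along the two sides of the path (s, t), (s', t), (s', t').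
-/
theorem lipOnBox_of_hasDerivAt {R L : ℝ} {f f₁ f₂ : ℝ → ℝ → ℂ}
    (h₁ : ∀ s t, HasDerivAt (fun s => f s t) (f₁ s t) s)
    (h₂ : ∀ s t, HasDerivAt (fun t => f s t) (f₂ s t) t)
    (b : ∀ s t, |s| ≤ R → |t| ≤ R → ‖f s t‖ ≤ L)
    (b₁ : ∀ s t, |s| ≤ R → |t| ≤ R → ‖f₁ s t‖ ≤ L)
    (b₂ : ∀ s t, |s| ≤ R → |t| ≤ R → ‖f₂ s t‖ ≤ L) : LipOnBox R L f := by
  refine ⟨b, fun s t s' t' hs ht hs' ht' => ?_⟩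
  have e₁ : ‖f s t - f s' t‖ ≤ L * |s - s'| := by
    simpa using (convex_Icc (-R) R).norm_image_sub_le_of_norm_hasDerivWithin_le
      (f := fun s => f s t) (f' := fun s => f₁ s t) (C := L)
      (fun x _ => (h₁ x t).hasDerivWithinAt) (fun x hx => b₁ x t (abs_le.2 hx) ht)
      (abs_le.1 hs') (abs_le.1 hs)
  have e₂ : ‖f s' t - f s' t'‖ ≤ L * |t - t'| := by
    simpa using (convex_Icc (-R) R).norm_image_sub_le_of_norm_hasDerivWithin_le
      (f := fun t => f s' t) (f' := fun t => f₂ s' t) (C := L)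
      (fun x _ => (h₂ s' x).hasDerivWithinAt) (fun x hx => b₂ s' x hs' (abs_le.2 hx))
      (abs_le.1 ht') (abs_le.1 ht)
  calc ‖f s t - f s' t'‖ = ‖(f s t - f s' t) + (f s' t - f s' t')‖ := by congr 1; ring
    _ ≤ _ := (norm_add_le _ _).trans (by rw [mul_add]; exact add_le_add e₁ e₂)

theorem lipOnBox_besselB_succ (R : ℝ) (j : ℕ) :
    LipOnBox R (boxBound R) fun s t => (besselB (j + 1) s t : ℂ) := by
  refine lipOnBox_of_hasDerivAt (fun s t => (hasDerivAt_besselB_succ_left j s t).ofReal_comp)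
    (fun s t => (hasDerivAt_besselB_right (j + 1) s t).ofReal_comp) ?_ ?_ ?_ <;>
  · intro s t hs ht
    rw [Complex.norm_real, Real.norm_eq_abs]
    try rw [abs_neg]
    exact abs_besselB_le_boxBound hs ht _

theorem lipOnBox_besselB_zero (R : ℝ) :
    LipOnBox R (boxBound R) fun s t => (besselB 0 s t : ℂ) := by
  refine lipOnBox_of_hasDerivAt (fun s t => (hasDerivAt_besselB_zero_left s t).ofReal_comp)
    (fun s t => (hasDerivAt_besselB_right 0 s t).ofReal_comp) ?_ ?_ ?_ <;>
  · intro s t hs ht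
    rw [Complex.norm_real, Real.norm_eq_abs]
    first | exact abs_besselB_le_boxBound hs ht _ | exact abs_besselB_le_boxBound ht hs _

theorem lipOnBox_besselSum_succ (R : ℝ) {ω : ℂ} (hω : ‖ω‖ ≤ 1) (k : ℕ) :
    LipOnBox R (boxBound R) (besselSum (k + 1) ω) := by
  refine lipOnBox_of_hasDerivAt (fun s t => hasDerivAt_besselSum_succ_left hω k s t)
    (fun s t => hasDerivAt_besselSum_right hω (k + 1) s t) ?_ ?_ ?_ <;>
  · intro s t hs ht
    try rw [norm_neg]
    exact norm_besselSum_le hω hs ht _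

theorem lipOnBox_besselSum_zero (R : ℝ) {ω : ℂ} (hω : ‖ω‖ ≤ 1) :
    LipOnBox R (2 * boxBound R) (besselSum 0 ω) := by
  have h0 := (boxBound_pos R).le
  refine lipOnBox_of_hasDerivAt (fun s t => hasDerivAt_besselSum_zero_left hω s t)
    (fun s t => hasDerivAt_besselSum_right hω 0 s t) ?_ ?_ ?_
  · intro s t hs ht
    linarith [norm_besselSum_le hω hs ht 0]
  · intro s t hs ht
    refine (norm_sub_le _ _).trans ?_
    rw [norm_mul, Complex.norm_real, Real.norm_eq_abs]
    have h1 := abs_besselB_le_boxBound ht hs 1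
    have h2 := norm_besselSum_le hω hs ht 0
    have h3 : ‖ω‖ * ‖besselSum 0 ω s t‖ ≤ 1 * boxBound R := by gcongr
    linarith
  · intro s t hs ht
    linarith [norm_besselSum_le hω hs ht 1]

theorem continuous_of_lipOnBox {f : ℝ → ℝ → ℂ} {L : ℝ → ℝ} (h : ∀ R, LipOnBox R (L R) f) :
    Continuous fun z : ℝ × ℝ => f z.1 z.2 := by
  rw [continuous_iff_continuousAt]
  rintro ⟨s, t⟩
  set R : ℝ := max |s| |t| + 1
  have hs : |s| < R := (le_max_left _ _).trans_lt (lt_add_one _)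
  have ht : |t| < R := (le_max_right _ _).trans_lt (lt_add_one _)
  refine tendsto_iff_norm_sub_tendsto_zero.2 ?_
  have hlim : Tendsto (fun z : ℝ × ℝ => L R * (|z.1 - s| + |z.2 - t|)) (𝓝 (s, t)) (𝓝 0) := by
    have : Continuous fun z : ℝ × ℝ => L R * (|z.1 - s| + |z.2 - t|) := by fun_prop
    simpa using this.tendsto (s, t)
  refine squeeze_zero' (Eventually.of_forall fun _ => norm_nonneg _) ?_ hlim
  have e1 : ∀ᶠ z : ℝ × ℝ in 𝓝 (s, t), |z.1| < R :=
    (continuous_fst.abs.tendsto (s, t)).eventually_lt_const hs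
  have e2 : ∀ᶠ z : ℝ × ℝ in 𝓝 (s, t), |z.2| < R :=
    (continuous_snd.abs.tendsto (s, t)).eventually_lt_const ht
  filter_upwards [e1, e2] with z h1 h2
  exact (h R).2 z.1 z.2 s t h1.le h2.le hs.le ht.le

/-! ### Rows of the ordered product -/

/-- The matrix which is `c` at `(j, j)` and `(k, k)`, `-β` at `(j, k)`, `α` at `(k, j)`, and agrees
with the identity elsewhere (for `j ≠ k`). -/
def planeStep {N : ℕ} (c α β : ℂ) (j k : Fin N) : Matrix (Fin N) (Fin N) ℂ :=
  1 + (c - 1) • (Matrix.single j j 1 + Matrix.single k k 1)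
    - β • Matrix.single j k 1 + α • Matrix.single k j 1

theorem rotation_eq_planeStep (a b : ℝ) (ν : ℂ) (N : ℕ) :
    rotation a b ν N = planeStep (Real.cos (mesh a b N * ‖ν‖) : ℂ)
      (ν / ‖ν‖ * Real.sin (mesh a b N * ‖ν‖)) (star ν / ‖ν‖ * Real.sin (mesh a b N * ‖ν‖)) := rfl

theorem linearized_eq_planeStep (a b : ℝ) (ν : ℂ) (N : ℕ) :
    linearized a b ν N = planeStep 1 (mesh a b N * ν) (mesh a b N * star ν) := by
  ext j k : 2
  simp [linearized, planeStep, sub_eq_add_neg, add_assoc]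

theorem vecMul_planeStep {N : ℕ} (c α β : ℂ) {j k : Fin N} (hjk : j ≠ k) (w : Fin N → ℂ)
    (l : Fin N) : Matrix.vecMul w (planeStep c α β j k) l =
      if l = j then c * w j + α * w k else if l = k then c * w k - β * w j else w l := by
  have hs : ∀ (p q : Fin N), Matrix.vecMul w (Matrix.single p q (1 : ℂ)) l
      = if l = q then w p else 0 := by
    intro p q
    simp only [Matrix.vecMul, dotProduct, Matrix.single_apply]
    rw [Finset.sum_eq_single p]
    · by_cases h : l = q <;> simp [h, eq_comm]
    · intro b _ hb; simp [hb.symm]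
    · simp
  simp only [planeStep, Matrix.vecMul_add, Matrix.vecMul_sub, Matrix.vecMul_smul, Matrix.vecMul_one,
    Pi.add_apply, Pi.sub_apply, Pi.smul_apply, hs, smul_eq_mul]
  by_cases h1 : l = j
  · subst h1; simp [hjk]; ring
  · by_cases h2 : l = k
    · subst h2; simp [h1]; ring
    · simp [h1, h2]

/-- The values at position `j` while a row vector `w` is multiplied by the factors `(j, j + 1)`,
`(j, j + 2)`, …: the value after the factor `(j, k)` (and `w k` for `k ≤ j`). -/
def sweep (c α : ℂ) (w : ℕ → ℂ) (j : ℕ) : ℕ → ℂ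
  | 0 => w 0
  | k + 1 => if j ≤ k then c * sweep c α w j k + α * w (k + 1) else w (k + 1)

/-- The row vector `w` after the factors with first index smaller than `j`, at positions `≥ j`. -/
def stage (c α β : ℂ) (w : ℕ → ℂ) : ℕ → ℕ → ℂ
  | 0 => w
  -- The factor (j, k) reads position j before absorbing position k, hence the index k - 1. Only k >
  -- j matters, so the truncation at k = 0 is harmless.
  | j + 1 => fun k => c * stage c α β w j k - β * sweep c α (stage c α β w j) j (k - 1)

theorem sweep_of_le (c α : ℂ) (w : ℕ → ℂ) {j k : ℕ} (h : k ≤ j) : sweep c α w j k = w k := by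
  cases k with
  | zero => rfl
  | succ k => rw [sweep, if_neg (by omega)]

theorem sweep_succ (c α : ℂ) (w : ℕ → ℂ) {j k : ℕ} (h : j ≤ k) :
    sweep c α w j (k + 1) = c * sweep c α w j k + α * w (k + 1) := by
  rw [sweep, if_pos h]

theorem stage_succ (c α β : ℂ) (w : ℕ → ℂ) (j k : ℕ) :
    stage c α β w (j + 1) k
      = c * stage c α β w j k - β * sweep c α (stage c α β w j) j (k - 1) := rfl

/-- The row vector `w` after all factors with first index `< j` and those with first index `j` and
second index `< m`. -/
def rowState (N : ℕ) (c α β : ℂ) (w : ℕ → ℂ) (j m : ℕ) (l : Fin N) : ℂ :=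
  if (l : ℕ) < j then sweep c α (stage c α β w l) l (N - 1)
  -- The last factor applied has second index m - 1; as long as none has been applied the sweep sits
  -- at its starting index j.
  else if (l : ℕ) = j then sweep c α (stage c α β w j) j (max j (m - 1))
  else if (l : ℕ) < m then stage c α β w (j + 1) l else stage c α β w j l

theorem rowState_zero_zero (N : ℕ) (c α β : ℂ) (w : ℕ → ℂ) :
    rowState N c α β w 0 0 = fun l : Fin N => w l := by
  funext l
  simp only [rowState, Nat.not_lt_zero, if_false]
  split_ifs with h
  · simp [sweep, stage, h]
  · rfl

/-- When loop j is complete, position j is final and position j + 1 becomes the start of the next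
sweep. -/
theorem rowState_last (N : ℕ) (c α β : ℂ) (w : ℕ → ℂ) (j : ℕ) :
    rowState N c α β w j N = rowState N c α β w (j + 1) 0 := by
  funext l
  have hl := l.2
  simp only [rowState]
  rcases lt_trichotomy (l : ℕ) j with h | h | h
  · rw [if_pos h, if_pos (by omega)]
  · rw [if_neg (by omega), if_pos h, if_pos (by omega), h, max_eq_right (by omega)]
  · rw [if_neg (by omega), if_neg (by omega), if_pos hl, if_neg (by omega)]
    split_ifs with h2
    · rw [sweep_of_le, h2] <;> simp
    · omega
    · rfl

open Matrix in
theorem rowState_vecMul {N : ℕ} (c α β : ℂ) (w : ℕ → ℂ) {j m : ℕ} (hj : j < N) (hm : m < N)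
    (hjm : j < m) :
    rowState N c α β w j m ᵥ* planeStep c α β ⟨j, hj⟩ ⟨m, hm⟩ = rowState N c α β w j (m + 1) := by
  funext l
  rw [vecMul_planeStep _ _ _ (by simpa [Fin.ext_iff] using hjm.ne)]
  simp only [rowState, Fin.ext_iff, lt_irrefl, if_false, if_true, hjm.ne', Nat.add_sub_cancel,
    hjm.not_gt]
  obtain ⟨m, rfl⟩ : ∃ q, m = q + 1 := ⟨m - 1, by omega⟩
  have e₁ : max j (m + 1 - 1) = m := by omega
  have e₂ : max j (m + 1) = m + 1 := by omega
  rw [e₁, e₂, sweep_succ _ _ _ (show j ≤ m by omega)]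
  split_ifs <;> first | rfl | omega | skip
  have h : (l : ℕ) = m + 1 := by assumption
  rw [h, stage_succ, Nat.add_sub_cancel]

/-- This handles the indices k ≤ j, at which the padded product has the factor 1. -/
theorem rowState_succ_of_le (N : ℕ) (c α β : ℂ) (w : ℕ → ℂ) {j m : ℕ} (hjm : m ≤ j) :
    rowState N c α β w j (m + 1) = rowState N c α β w j m := by
  funext l
  simp only [rowState]
  rw [max_eq_left (show m + 1 - 1 ≤ j by omega), max_eq_left (show m - 1 ≤ j by omega)]
  split_ifs <;> first | rfl | omega

theorem prod_map_finRange {N : ℕ} {M : Type*} [Monoid M] (f : Fin N → M) (g : ℕ → M)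
    (h : ∀ i : Fin N, f i = g i) : ((List.finRange N).map f).prod = ((List.range N).map g).prod := by
  rw [← List.map_coe_finRange_eq_range, List.map_map]
  congr 1
  exact List.map_congr_left fun i _ => h i

theorem prod_map_filter {ι M : Type*} [Monoid M] (p : ι → Prop) [DecidablePred p] (f : ι → M)
    (l : List ι) : ((l.filter fun k => p k).map f).prod
      = (l.map fun k => if p k then f k else 1).prod := by
  induction l with
  | nil => simp
  | cons a l ih => by_cases h : p a <;> simp [h, ih]

open Matrix in
/-- The rows of the ordered double product in terms of the two-step recursion. -/
theorem vecMul_orderedProd {N : ℕ} (c α β : ℂ) (w : ℕ → ℂ) :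
    (fun l : Fin N => w l) ᵥ* orderedProd (planeStep (N := N) c α β)
      = fun l : Fin N => sweep c α (stage c α β w l) l (N - 1) := by
  classical
  -- Padding by identity factors lets both loops run over the full range, so that induction on the
  -- length of the range applies.
  set g : ℕ → ℕ → Matrix (Fin N) (Fin N) ℂ := fun j k =>
    if h : j < N ∧ k < N then (if j < k then planeStep c α β ⟨j, h.1⟩ ⟨k, h.2⟩ else 1) else 1 with hg
  have h1 : orderedProd (planeStep (N := N) c α β)
      = ((List.range N).map fun j => ((List.range N).map fun k => g j k).prod).prod := by
    rw [orderedProd]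
    refine prod_map_finRange _ _ fun j => ?_
    rw [prod_map_filter]
    refine prod_map_finRange _ _ fun k => ?_
    simp [hg]
  have inner : ∀ j < N, ∀ m ≤ N, rowState N c α β w j 0 ᵥ* ((List.range m).map fun k => g j k).prod
      = rowState N c α β w j m := by
    intro j hj m
    induction m with
    | zero => simp
    | succ m ih =>
      intro hm
      rw [List.prod_range_succ, ← Matrix.vecMul_vecMul, ih (by omega)]
      by_cases hjm : j < m
      · simp only [hg, hjm, if_true]
        rw [dif_pos ⟨hj, by omega⟩, rowState_vecMul _ _ _ _ _ _ hjm]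
      · simp only [hg, hjm, if_false, dite_eq_ite, ite_self, Matrix.vecMul_one]
        rw [rowState_succ_of_le _ _ _ _ _ (by omega)]
  have outer : ∀ m ≤ N, (fun l : Fin N => w l) ᵥ*
      ((List.range m).map fun j => ((List.range N).map fun k => g j k).prod).prod
      = rowState N c α β w m 0 := by
    intro m
    induction m with
    | zero => intro _; simp [rowState_zero_zero]
    | succ m ih =>
      intro hm
      rw [List.prod_range_succ, ← Matrix.vecMul_vecMul, ih (by omega), inner m (by omega) N le_rfl,
        rowState_last]
  rw [h1, outer N le_rfl]
  funext l
  rw [rowState, if_pos l.2]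

theorem orderedProd_planeStep_apply {N : ℕ} (c α β : ℂ) (i j : Fin N) :
    orderedProd (planeStep (N := N) c α β) i j
      = sweep c α (stage c α β (Pi.single (i : ℕ) 1) j) j (N - 1) := by
  have := congrFun (vecMul_orderedProd (N := N) c α β (Pi.single (i : ℕ) 1)) j
  rw [← this]
  have : (fun l : Fin N => (Pi.single (i : ℕ) (1 : ℂ) : ℕ → ℂ) l) = Pi.single i 1 := by
    funext l
    simp [Pi.single_apply, Fin.ext_iff]
  rw [this, Matrix.single_one_vecMul]
  rfl

/-! ### Stability of the discrete Goursat problem -/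

/-- Discrete Gronwall along one sweep: as long as the stage errors and the source stay below E, the
three contributions multiply the bound by at most (1 + τ) + τ + τ per step. -/
theorem sweep_error_le {τ E : ℝ} {n N : ℕ} {e q : ℕ → ℝ} (hτ : 0 ≤ τ) (hE : 0 ≤ E)
    (h0 : q n ≤ E) (he : ∀ k, n < k → k < N → e k ≤ E)
    (hq : ∀ k, n ≤ k → k + 1 < N → q (k + 1) ≤ (1 + τ) * q k + τ * e (k + 1) + τ * E) :
    ∀ k, n ≤ k → k < N → q k ≤ E * (1 + 3 * τ) ^ k := by
  have hρ : (1 : ℝ) ≤ 1 + 3 * τ := by linarith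
  intro k hk
  induction k, hk using Nat.le_induction with
  | base => exact fun _ => h0.trans (le_mul_of_one_le_right hE (one_le_pow₀ hρ))
  | succ k hk ih =>
    intro hkN
    have h1 := ih (by omega)
    have h2 := he (k + 1) (by omega) hkN
    have h3 : E ≤ E * (1 + 3 * τ) ^ k := le_mul_of_one_le_right hE (one_le_pow₀ hρ)
    calc q (k + 1) ≤ (1 + τ) * q k + τ * e (k + 1) + τ * E := hq k hk hkN
      _ ≤ (1 + τ) * (E * (1 + 3 * τ) ^ k) + τ * (E * (1 + 3 * τ) ^ k)
          + τ * (E * (1 + 3 * τ) ^ k) := by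
        gcongr
        exact h2.trans h3
      _ = E * (1 + 3 * τ) ^ (k + 1) := by ring

/-- Gronwall in both directions. A bound E on the stage errors bounds the sweep errors by E G, and
the next stage is then bounded by ((1 + τ) + τ G + τ) E. Sweep j starts at k₀ j, and stage errors
are controlled from k₁ j on. In `hb` the starting error is either prescribed or inherited from the
stage at the same point; these are the boundary conditions on a line Z = X₀ and on the diagonal. -/
theorem goursat_error_le {τ η G : ℝ} {j₀ J N : ℕ} {k₀ k₁ : ℕ → ℕ} {e q : ℕ → ℕ → ℝ}
    (hτ : 0 ≤ τ) (hη : 0 ≤ η) (hG : (1 + 3 * τ) ^ N ≤ G)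
    (hk₁ : ∀ j, k₁ j ≤ k₀ j + 1) (hk₀ : ∀ j, k₀ j + 1 ≤ k₁ (j + 1))
    (h0 : ∀ k, k₁ j₀ ≤ k → k < N → e j₀ k ≤ η)
    (hb : ∀ j, j₀ ≤ j → j < J → q j (k₀ j) ≤ η ∨ (k₁ j ≤ k₀ j ∧ q j (k₀ j) ≤ e j (k₀ j)))
    (hkN : ∀ j, j < J → k₀ j < N)
    (hq : ∀ j, j₀ ≤ j → j < J → ∀ k, k₀ j ≤ k → k + 1 < N →
      q j (k + 1) ≤ (1 + τ) * q j k + τ * e j (k + 1) + τ * η)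
    (he : ∀ j, j₀ ≤ j → j < J → ∀ k, k₀ j ≤ k → k + 1 < N →
      e (j + 1) (k + 1) ≤ (1 + τ) * e j (k + 1) + τ * q j k + τ * η) :
    ∀ j, j₀ ≤ j → (j ≤ J → ∀ k, k₁ j ≤ k → k < N → e j k ≤ η * (1 + (2 + G) * τ) ^ j) ∧
      (j < J → ∀ k, k₀ j ≤ k → k < N → q j k ≤ η * (1 + (2 + G) * τ) ^ j * G) := by
  have hρ : (1 : ℝ) ≤ 1 + 3 * τ := by linarith
  have hG1 : 1 ≤ G := (one_le_pow₀ hρ).trans hG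
  have hH : (1 : ℝ) ≤ 1 + (2 + G) * τ := by
    have : 0 ≤ (2 + G) * τ := by positivity
    linarith
  have hqe : ∀ j, j₀ ≤ j → j < J →
      (∀ k, k₁ j ≤ k → k < N → e j k ≤ η * (1 + (2 + G) * τ) ^ j) →
      ∀ k, k₀ j ≤ k → k < N → q j k ≤ η * (1 + (2 + G) * τ) ^ j * G := by
    intro j hj hjJ hej k hk hkN'
    have hηE : η ≤ η * (1 + (2 + G) * τ) ^ j := le_mul_of_one_le_right hη (one_le_pow₀ hH)
    have hE : 0 ≤ η * (1 + (2 + G) * τ) ^ j := hη.trans hηE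
    have hb' : q j (k₀ j) ≤ η * (1 + (2 + G) * τ) ^ j := by
      rcases hb j hj hjJ with h | ⟨h, h'⟩
      · exact h.trans hηE
      · exact h'.trans (hej _ h (hkN j hjJ))
    refine (sweep_error_le hτ hE hb' (e := e j) (fun k h h' => hej k ((hk₁ j).trans h) h')
      (fun k h h' => (hq j hj hjJ k h h').trans (by gcongr)) k hk hkN').trans ?_
    gcongr
    exact (pow_le_pow_right₀ hρ hkN'.le).trans hG
  have key : ∀ j, j₀ ≤ j → (j ≤ J → ∀ k, k₁ j ≤ k → k < N → e j k ≤ η * (1 + (2 + G) * τ) ^ j) := by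
    intro j hj
    induction j, hj using Nat.le_induction with
    | base =>
      exact fun _ k hk hkN => (h0 k hk hkN).trans (le_mul_of_one_le_right hη (one_le_pow₀ hH))
    | succ j hj ih =>
      intro hjJ k hk hkN'
      have ih' := ih (by omega)
      obtain ⟨k, rfl⟩ : ∃ l, k = l + 1 := ⟨k - 1, by have := hk₀ j; omega⟩
      have hk0 : k₀ j ≤ k := by have := hk₀ j; omega
      have h1 := ih' (k + 1) ((hk₁ j).trans (by omega)) hkN'
      have h2 := hqe j hj (by omega) ih' k hk0 (by omega)
      have hηE : η ≤ η * (1 + (2 + G) * τ) ^ j := le_mul_of_one_le_right hη (one_le_pow₀ hH)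
      set E := η * (1 + (2 + G) * τ) ^ j
      calc e (j + 1) (k + 1) ≤ (1 + τ) * e j (k + 1) + τ * q j k + τ * η :=
            he j hj (by omega) k hk0 hkN'
        _ ≤ (1 + τ) * E + τ * (E * G) + τ * E := by gcongr
        _ = E * (1 + (2 + G) * τ) := by ring
        _ = _ := by rw [pow_succ, ← mul_assoc]
  exact fun j hj => ⟨key j hj, fun hjJ => hqe j hj hjJ (key j hj hjJ.le)⟩

/-- One step of either recursion: the linear part propagates the old errors, and the defect of the
approximate solution is d times O(d²), coming from c - 1, from γ - κd and from the difference
quotient. -/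
theorem step_error_le {c γ κ x X y Y X' : ℂ} {d C L τ : ℝ} (hd : 0 ≤ d)
    (hc : ‖c - 1‖ ≤ C * d ^ 2) (hγ : ‖γ - κ * d‖ ≤ C * d ^ 2) (hcτ : ‖c‖ ≤ 1 + τ) (hγτ : ‖γ‖ ≤ τ)
    (hX : ‖X‖ ≤ L) (hY : ‖Y‖ ≤ L) (hX' : ‖X' - X - d * κ * Y‖ ≤ L * d ^ 2) :
    ‖c * x + γ * y - d * X'‖
      ≤ (1 + τ) * ‖x - d * X‖ + τ * ‖y - d * Y‖ + (2 * C + 1) * L * d ^ 3 := by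
  have hC : 0 ≤ C * d ^ 2 := (norm_nonneg _).trans hc
  have hdn : ‖(d : ℂ)‖ = d := by rw [Complex.norm_real, Real.norm_of_nonneg hd]
  have e : c * x + γ * y - d * X' = c * (x - d * X) + γ * (y - d * Y)
      + d * ((c - 1) * X + (γ - κ * d) * Y - (X' - X - d * κ * Y)) := by ring
  have h1 : ‖(c - 1) * X‖ ≤ C * d ^ 2 * L := by rw [norm_mul]; gcongr
  have h2 : ‖(γ - κ * d) * Y‖ ≤ C * d ^ 2 * L := by rw [norm_mul]; gcongr
  have h3 : ‖(c - 1) * X + (γ - κ * d) * Y - (X' - X - d * κ * Y)‖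
      ≤ C * d ^ 2 * L + C * d ^ 2 * L + L * d ^ 2 :=
    (norm_sub_le _ _).trans (add_le_add ((norm_add_le _ _).trans (add_le_add h1 h2)) hX')
  rw [e]
  refine (norm_add₃_le).trans ?_
  rw [norm_mul, norm_mul, norm_mul, hdn]
  calc _ ≤ (1 + τ) * ‖x - d * X‖ + τ * ‖y - d * Y‖
        + d * (C * d ^ 2 * L + C * d ^ 2 * L + L * d ^ 2) := by gcongr
    _ = _ := by ring

/-- Coefficients `c`, `α`, `β` of a factor of the double product, which up to second order in the
mesh `d = T / N` are `1`, `ν d` and `ν̄ d`. -/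
structure StepCoeff (ν : ℂ) (C T : ℝ) (N : ℕ) (d : ℝ) (c α β : ℂ) : Prop where
  pos : 1 ≤ N
  nonneg : 0 ≤ d
  nonneg_const : 0 ≤ C
  mul_eq : N * d = T
  hc : ‖c - 1‖ ≤ C * d ^ 2
  hα : ‖α - ν * d‖ ≤ C * d ^ 2
  hβ : ‖β - star ν * d‖ ≤ C * d ^ 2

/-- A constant with `‖c‖ ≤ 1 + D d` and `‖α‖, ‖β‖ ≤ D d`. -/
def rate (ν : ℂ) (C T : ℝ) : ℝ := C * T + ‖ν‖ + 1

namespace StepCoeff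

variable {ν : ℂ} {C T : ℝ} {N : ℕ} {d : ℝ} {c α β : ℂ}

theorem le_total (h : StepCoeff ν C T N d c α β) : d ≤ T := by
  have := h.mul_eq
  have h1 : (1 : ℝ) ≤ N := by exact_mod_cast h.pos
  nlinarith [h.nonneg]

theorem one_le_rate (h : StepCoeff ν C T N d c α β) : 1 ≤ rate ν C T := by
  have h1 := h.nonneg_const
  have h2 : 0 ≤ T := h.nonneg.trans h.le_total
  have : 0 ≤ C * T := by positivity
  unfold rate
  linarith [norm_nonneg ν]

theorem rate_mul_nonneg (h : StepCoeff ν C T N d c α β) : 0 ≤ rate ν C T * d :=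
  mul_nonneg (zero_le_one.trans h.one_le_rate) h.nonneg

theorem sq_le (h : StepCoeff ν C T N d c α β) : C * d ^ 2 ≤ C * T * d := by
  have h1 := h.nonneg_const
  have h2 := h.nonneg
  calc C * d ^ 2 = C * d * d := by ring
    _ ≤ C * T * d := by gcongr; exact h.le_total

theorem norm_c_le (h : StepCoeff ν C T N d c α β) : ‖c‖ ≤ 1 + rate ν C T * d := by
  have h1 : ‖c‖ ≤ ‖c - 1‖ + ‖(1 : ℂ)‖ := by simpa using norm_add_le (c - 1) 1
  have := mul_nonneg (norm_nonneg ν) h.nonneg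
  rw [norm_one] at h1
  unfold rate
  nlinarith [h.hc, h.sq_le, h.nonneg]

theorem norm_le_of_sub {γ κ : ℂ} (h : StepCoeff ν C T N d c α β) (hκ : ‖κ‖ = ‖ν‖)
    (hγ : ‖γ - κ * d‖ ≤ C * d ^ 2) : ‖γ‖ ≤ rate ν C T * d := by
  have h1 : ‖γ‖ ≤ ‖γ - κ * d‖ + ‖κ * d‖ := by simpa using norm_add_le (γ - κ * d) (κ * d)
  rw [norm_mul, Complex.norm_real, Real.norm_of_nonneg h.nonneg, hκ] at h1
  unfold rate
  nlinarith [h.sq_le, h.nonneg]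

theorem norm_α_le (h : StepCoeff ν C T N d c α β) : ‖α‖ ≤ rate ν C T * d :=
  h.norm_le_of_sub rfl h.hα

theorem norm_β_le (h : StepCoeff ν C T N d c α β) : ‖β‖ ≤ rate ν C T * d :=
  h.norm_le_of_sub (norm_star ν) h.hβ

theorem one_add_pow_le (h : StepCoeff ν C T N d c α β) {x : ℝ} (hx : 0 ≤ x) {n : ℕ} (hn : n ≤ N) :
    (1 + x * (rate ν C T * d)) ^ n ≤ Real.exp (x * (rate ν C T * T)) := by
  have h1 : 0 ≤ x * (rate ν C T * d) := mul_nonneg hx h.rate_mul_nonneg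
  calc (1 + x * (rate ν C T * d)) ^ n ≤ (1 + x * (rate ν C T * d)) ^ N :=
        pow_le_pow_right₀ (by linarith) hn
    _ ≤ Real.exp (x * (rate ν C T * d)) ^ N := by
        gcongr
        linarith [Real.add_one_le_exp (x * (rate ν C T * d))]
    _ = Real.exp (x * (rate ν C T * T)) := by
        rw [← Real.exp_nat_mul, ← h.mul_eq]; congr 1; ring

theorem norm_pow_c_le (h : StepCoeff ν C T N d c α β) {n : ℕ} (hn : n ≤ N) :
    ‖c ^ n‖ ≤ Real.exp (rate ν C T * T) := by
  rw [norm_pow]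
  have := h.one_add_pow_le (x := 1) zero_le_one hn
  rw [one_mul, one_mul] at this
  exact (pow_le_pow_left₀ (norm_nonneg _) h.norm_c_le n).trans this

/-- Telescoping gives at most N defects of size O(d²), and N d = T. -/
theorem norm_pow_c_sub_one_le (h : StepCoeff ν C T N d c α β) {n : ℕ} (hn : n ≤ N) :
    ‖c ^ n - 1‖ ≤ C * T * Real.exp (rate ν C T * T) * d := by
  have key : ∀ n ≤ N, ‖c ^ n - 1‖ ≤ n * (C * d ^ 2 * Real.exp (rate ν C T * T)) := by
    intro n
    induction n with
    | zero => simp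
    | succ n ih =>
      intro hn
      have e : c ^ (n + 1) - 1 = c ^ n * (c - 1) + (c ^ n - 1) := by ring
      have h1 : ‖c ^ n * (c - 1)‖ ≤ Real.exp (rate ν C T * T) * (C * d ^ 2) := by
        rw [norm_mul]
        gcongr
        · exact h.norm_pow_c_le (by omega)
        · exact h.hc
      rw [e]
      refine (norm_add_le _ _).trans ?_
      push_cast
      linarith [ih (by omega)]
  refine (key n hn).trans ?_
  have h1 : (n : ℝ) ≤ N := by exact_mod_cast hn
  have h2 := h.nonneg_const
  calc (n : ℝ) * (C * d ^ 2 * Real.exp (rate ν C T * T))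
      ≤ N * (C * d ^ 2 * Real.exp (rate ν C T * T)) := by gcongr
    _ = C * (N * d) * Real.exp (rate ν C T * T) * d := by ring
    _ = _ := by rw [h.mul_eq]

end StepCoeff

/-- Grid functions which satisfy the scheme of the double product up to second order. -/
structure GoursatApprox (ν : ℂ) (L : ℝ) (N : ℕ) (d : ℝ) (P V : ℕ → ℕ → ℂ) : Prop where
  bound_P : ∀ j k, j ≤ N → k ≤ N → ‖P j k‖ ≤ L
  bound_V : ∀ j k, j ≤ N → k ≤ N → ‖V j k‖ ≤ L
  step_P : ∀ j k, j ≤ N → k < N → ‖P j (k + 1) - P j k - d * ν * V j (k + 1)‖ ≤ L * d ^ 2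
  step_V : ∀ j k, j < N → k < N →
    ‖V (j + 1) (k + 1) - V j (k + 1) - d * (-star ν) * P j k‖ ≤ L * d ^ 2

/-- Stability: from initial and boundary errors `≤ η₀ d²` the scheme stays within `K d²` of `d`
times the approximate solution. -/
theorem exists_goursat_stability (ν : ℂ) (C T L η₀ : ℝ) (hη₀ : 0 ≤ η₀) :
    ∃ K : ℝ, ∀ (N : ℕ) (d : ℝ) (c α β : ℂ) (P V : ℕ → ℕ → ℂ) (w : ℕ → ℂ) (j₀ J : ℕ)
      (k₀ k₁ : ℕ → ℕ), StepCoeff ν C T N d c α β → GoursatApprox ν L N d P V → J ≤ N →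
      (∀ j, k₁ j ≤ k₀ j + 1) → (∀ j, k₀ j + 1 ≤ k₁ (j + 1)) → (∀ j, j < J → j ≤ k₀ j ∧ k₀ j < N) →
      (∀ k, k₁ j₀ ≤ k → k < N → ‖stage c α β w j₀ k - d * V j₀ k‖ ≤ η₀ * d ^ 2) →
      (∀ j, j₀ ≤ j → j < J →
        ‖sweep c α (stage c α β w j) j (k₀ j) - d * P j (k₀ j)‖ ≤ η₀ * d ^ 2 ∨
        (k₁ j ≤ k₀ j ∧ k₀ j = j ∧ P j j = V j j)) →
      ∀ j, j₀ ≤ j →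
        (j ≤ J → ∀ k, k₁ j ≤ k → k < N → ‖stage c α β w j k - d * V j k‖ ≤ K * d ^ 2) ∧
        (j < J → ∀ k, k₀ j ≤ k → k < N →
          ‖sweep c α (stage c α β w j) j k - d * P j k‖ ≤ K * d ^ 2) := by
  set D := rate ν C T
  -- G bounds (1 + 3τ)^N, the growth along one sweep; η₁ dominates both the data errors and the
  -- local defects.
  set G := Real.exp (3 * (D * T))
  set η₁ := max η₀ ((2 * C + 1) * L)
  have hG0 : 0 ≤ G := (Real.exp_pos _).le
  have hG1 : 0 ≤ 2 + G := by positivity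
  refine ⟨η₁ * Real.exp ((2 + G) * (D * T)) * (1 + G), ?_⟩
  intro N d c α β P V w j₀ J k₀ k₁ hs ha hJN hk₁ hk₀ hkN h0 hb
  have hη₁ : 0 ≤ η₁ := hη₀.trans (le_max_left _ _)
  have hd := hs.nonneg
  set τ := D * d
  have hτ : 0 ≤ τ := hs.rate_mul_nonneg
  have hη : 0 ≤ η₁ * d ^ 2 := by positivity
  have hη01 : η₀ * d ^ 2 ≤ η₁ * d ^ 2 := by gcongr; exact le_max_left _ _
  -- The local defect O(d³) has the form τ η with η = η₁ d². The summand 1 in `rate` guarantees d ≤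
  -- τ.
  have htrunc : (2 * C + 1) * L * d ^ 3 ≤ τ * (η₁ * d ^ 2) := by
    have h1 : (2 * C + 1) * L ≤ η₁ := le_max_right _ _
    calc (2 * C + 1) * L * d ^ 3 ≤ η₁ * d ^ 3 := by gcongr
      _ = 1 * d * (η₁ * d ^ 2) := by ring
      _ ≤ D * d * (η₁ * d ^ 2) := by gcongr; exact hs.one_le_rate
  have main := goursat_error_le (J := J) (j₀ := j₀) (k₀ := k₀) (k₁ := k₁) (N := N)
    (e := fun j k => ‖stage c α β w j k - d * V j k‖)
    (q := fun j k => ‖sweep c α (stage c α β w j) j k - d * P j k‖)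
    hτ hη (hs.one_add_pow_le (by norm_num) le_rfl) hk₁ hk₀
    (fun k h h' => (h0 k h h').trans hη01) ?_ (fun j hj => (hkN j hj).2) ?_ ?_
  · intro j hj
    have hH : ∀ j ≤ N, (1 + (2 + G) * τ) ^ j ≤ Real.exp ((2 + G) * (D * T)) :=
      fun j h => hs.one_add_pow_le hG1 h
    constructor
    · intro hjJ k hk hkN'
      refine ((main j hj).1 hjJ k hk hkN').trans ?_
      calc η₁ * d ^ 2 * (1 + (2 + G) * τ) ^ j ≤ η₁ * d ^ 2 * Real.exp ((2 + G) * (D * T)) := by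
            gcongr; exact hH j (hjJ.trans hJN)
        _ = η₁ * Real.exp ((2 + G) * (D * T)) * 1 * d ^ 2 := by ring
        _ ≤ _ := by gcongr; linarith
    · intro hjJ k hk hkN'
      refine ((main j hj).2 hjJ k hk hkN').trans ?_
      calc η₁ * d ^ 2 * (1 + (2 + G) * τ) ^ j * G
          ≤ η₁ * d ^ 2 * Real.exp ((2 + G) * (D * T)) * G := by
            gcongr; exact hH j (hjJ.le.trans hJN)
        _ = η₁ * Real.exp ((2 + G) * (D * T)) * G * d ^ 2 := by ring
        _ ≤ _ := by gcongr; linarith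
  · intro j hj hjJ
    rcases hb j hj hjJ with h | ⟨h, h', h''⟩
    · exact Or.inl (h.trans hη01)
    · refine Or.inr ⟨h, ?_⟩
      rw [h', sweep_of_le _ _ _ le_rfl, h'']
  · intro j hj hjJ k hk hkN'
    rw [sweep_succ _ _ _ ((hkN j hjJ).1.trans hk)]
    refine (step_error_le hd hs.hc hs.hα hs.norm_c_le hs.norm_α_le (ha.bound_P j k (by omega)
      (by omega)) (ha.bound_V j (k + 1) (by omega) (by omega))
      (ha.step_P j k (by omega) (by omega))).trans ?_
    gcongr
  · intro j hj hjJ k hk hkN'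
    rw [stage_succ, Nat.add_sub_cancel, sub_eq_add_neg (c * _), ← neg_mul]
    refine (step_error_le hd hs.hc (γ := -β) (κ := -star ν) ?_ hs.norm_c_le ?_
      (ha.bound_V j (k + 1) (by omega) (by omega)) (ha.bound_P j k (by omega)
      (by omega)) (ha.step_V j k (by omega) (by omega))).trans ?_
    · rw [show -β - -star ν * (d : ℂ) = -(β - star ν * d) by ring, norm_neg]
      exact hs.hβ
    · rw [norm_neg]; exact hs.norm_β_le
    · gcongr

/-! ### The rows started at a unit vector -/

/-- Causality: a value at position i first enters a sweep with first index j < i at the factor (j,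
i), so nothing reaches the positions from j up to i - 1 in these stages. -/
theorem stage_single_of_lt (c α β : ℂ) {i j k : ℕ} (hjk : j ≤ k) (hk : k < i) :
    stage c α β (Pi.single i 1) j k = 0 ∧
      sweep c α (stage c α β (Pi.single i 1) j) j k = 0 := by
  have hsw : ∀ j, (∀ k, j ≤ k → k < i → stage c α β (Pi.single i 1) j k = 0) →
      ∀ k, j ≤ k → k < i → sweep c α (stage c α β (Pi.single i 1) j) j k = 0 := by
    intro j h k hjk
    induction k, hjk using Nat.le_induction with
    | base => intro hk; rw [sweep_of_le _ _ _ le_rfl, h j le_rfl hk]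
    | succ k hjk ih =>
      intro hk
      rw [sweep_succ _ _ _ hjk, ih (by omega), h _ (by omega) hk]; ring
  have hst : ∀ j, ∀ k, j ≤ k → k < i → stage c α β (Pi.single i 1) j k = 0 := by
    intro j
    induction j with
    | zero => intro k _ hk; exact Pi.single_eq_of_ne hk.ne _
    | succ j ih =>
      intro k hjk hk
      rw [stage_succ, ih k (by omega) hk, hsw j ih (k - 1) (by omega) (by omega)]; ring
  exact ⟨hst j k hjk hk, hsw j (hst j) k hjk hk⟩

theorem stage_single_self (c α β : ℂ) (i : ℕ) {j : ℕ} (hj : j ≤ i) :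
    stage c α β (Pi.single i 1) j i = c ^ j := by
  induction j with
  | zero => simp [stage]
  | succ j ih =>
    rw [stage_succ, ih (by omega),
      (stage_single_of_lt c α β (j := j) (k := i - 1) (by omega) (by omega)).2]
    ring

/-- This is the boundary value on the line Z = X₀: to leading order α c^j is ν d, which is the
condition P = ν. -/
theorem sweep_single_self (c α β : ℂ) {i j : ℕ} (hj : j < i) :
    sweep c α (stage c α β (Pi.single i 1) j) j i = α * c ^ j := by
  obtain ⟨k, rfl⟩ : ∃ k, i = k + 1 := ⟨i - 1, by omega⟩
  rw [sweep_succ _ _ _ (by omega), stage_single_self _ _ _ _ hj.le,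
    (stage_single_of_lt c α β (j := j) (k := k) (by omega) (by omega)).2]
  ring

/-- Rows of the double product, below the diagonal. -/
theorem exists_row_error_below (ν : ℂ) (C T L : ℝ) (hC : 0 ≤ C) (hT : 0 ≤ T) :
    ∃ K : ℝ, ∀ (N : ℕ) (d : ℝ) (c α β : ℂ) (P V : ℕ → ℕ → ℂ) (i : ℕ),
      StepCoeff ν C T N d c α β → GoursatApprox ν L N d P V → i < N →
      (∀ k, V 0 k = 0) → (∀ j, P j i = ν) →
      (∀ k, i < k → k < N →
        ‖stage c α β (Pi.single i 1) i k - d * V i k‖ ≤ K * d ^ 2) ∧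
      ∀ j, j < i →
        ‖sweep c α (stage c α β (Pi.single i 1) j) j (N - 1) - d * P j (N - 1)‖ ≤ K * d ^ 2 := by
  set D := rate ν C T
  -- The constant bounds (α - νd) c^j + νd (c^j - 1), the error of the boundary value, divided by
  -- d².
  have hη : 0 ≤ C * Real.exp (D * T) + ‖ν‖ * (C * T * Real.exp (D * T)) := by positivity
  obtain ⟨K, hK⟩ := exists_goursat_stability ν C T L _ hη
  refine ⟨K, fun N d c α β P V i hs ha hi hV hP => ?_⟩
  have hd := hs.nonneg
  have main := hK N d c α β P V (Pi.single i 1) 0 i (fun _ => i) (fun _ => i + 1) hs ha hi.le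
    (fun _ => le_rfl) (fun _ => le_rfl) (fun j hj => ⟨hj.le, hi⟩) ?_ ?_
  · exact ⟨fun k hk hkN => (main i (Nat.zero_le _)).1 le_rfl k hk hkN,
      fun j hj => (main j (Nat.zero_le _)).2 hj (N - 1) (by omega) (by omega)⟩
  · intro k hk _
    have : stage c α β (Pi.single i 1) 0 k = 0 := Pi.single_eq_of_ne (by omega) _
    rw [this, hV]
    simp only [mul_zero, sub_zero, norm_zero]
    positivity
  · intro j _ hj
    left
    have e : α * c ^ j - d * ν = (α - ν * d) * c ^ j + ν * d * (c ^ j - 1) := by ring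
    have hdn : ‖(d : ℂ)‖ = d := by rw [Complex.norm_real, Real.norm_of_nonneg hd]
    rw [sweep_single_self _ _ _ hj, hP, e]
    refine (norm_add_le _ _).trans ?_
    rw [norm_mul, norm_mul, norm_mul, hdn]
    calc _ ≤ (C * d ^ 2) * Real.exp (D * T) + ‖ν‖ * d * (C * T * Real.exp (D * T) * d) := by
          gcongr
          · exact hs.hα
          · exact hs.norm_pow_c_le (hj.le.trans hi.le)
          · exact hs.norm_pow_c_sub_one_le (hj.le.trans hi.le)
      _ = _ := by ring

/-- Rows of the double product, on the diagonal, and the initial values above the diagonal. -/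
theorem exists_row_error_diag (ν : ℂ) (C T L K₁ : ℝ) (hC : 0 ≤ C) (hT : 0 ≤ T) (hL : 0 ≤ L)
    (hK₁ : 0 ≤ K₁) :
    ∃ K : ℝ, 0 ≤ K ∧ ∀ (N : ℕ) (d : ℝ) (c α β : ℂ) (V : ℕ → ℂ) (i : ℕ),
      StepCoeff ν C T N d c α β → i < N → (∀ k, i < k → k < N → ‖V k‖ ≤ L) →
      (∀ k, i < k → k < N → ‖stage c α β (Pi.single i 1) i k - d * V k‖ ≤ K₁ * d ^ 2) →
      ‖sweep c α (stage c α β (Pi.single i 1) i) i (N - 1) - 1‖ ≤ K * d ∧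
      ∀ k, i < k → k < N →
        ‖stage c α β (Pi.single i 1) (i + 1) k - d * (V k - star ν)‖ ≤ K * d ^ 2 := by
  set D := rate ν C T with hD
  have hD0 : 0 ≤ D := by rw [hD, rate]; positivity
  -- The summands cover, after division by d, the initial error c^i - 1, the defect c - 1 and the
  -- size L + K₁ T of the stage values.
  set E := C * T * Real.exp (D * T) + C + L + K₁ * T with hE
  have hE0 : 0 ≤ E := by positivity
  set K₂ := E * Real.exp (3 * (D * T)) with hK₂
  refine ⟨K₂ + ((1 + D * T) * K₁ + C * T * L + D * K₂ + C), by positivity, ?_⟩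
  intro N d c α β V i hs hi hVL hV
  have hd := hs.nonneg
  have hdT := hs.le_total
  have hdn : ‖(d : ℂ)‖ = d := by rw [Complex.norm_real, Real.norm_of_nonneg hd]
  have hτ := hs.rate_mul_nonneg
  set s := stage c α β (Pi.single i 1) i with hsdef
  have hst : ∀ k, i < k → k < N → ‖s k‖ ≤ (L + K₁ * T) * d := by
    intro k h1 h2
    have e : s k = (s k - d * V k) + d * V k := by ring
    rw [e]
    refine (norm_add_le _ _).trans ?_
    rw [norm_mul, hdn]
    calc _ ≤ K₁ * d ^ 2 + d * L := by
          gcongr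
          · exact hV k h1 h2
          · exact hVL k h1 h2
      _ = K₁ * d * d + L * d := by ring
      _ ≤ K₁ * T * d + L * d := by gcongr
      _ = _ := by ring
  -- Sweep i starts at c^i and absorbs only terms α s of size O(d²), so over N steps it stays within
  -- O(d) of 1.
  have hsw : ∀ k, i ≤ k → k < N → ‖sweep c α s i k - 1‖ ≤ K₂ * d := by
    intro k h1 h2
    have hE1 : 0 ≤ E * d := by positivity
    refine (sweep_error_le (N := N) (e := fun k => ‖s k‖) hτ hE1
      (q := fun k => ‖sweep c α s i k - 1‖) (n := i) ?_ ?_ ?_ k h1 h2).trans ?_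
    · rw [sweep_of_le _ _ _ le_rfl, hsdef, stage_single_self _ _ _ _ le_rfl]
      refine (hs.norm_pow_c_sub_one_le hi.le).trans ?_
      gcongr
      have : 0 ≤ C + L + K₁ * T := by positivity
      rw [hE]; linarith
    · intro k h1 h2
      refine (hst k h1 h2).trans ?_
      gcongr
      have : 0 ≤ C * T * Real.exp (D * T) + C := by positivity
      rw [hE]; linarith
    · intro k h1 h2
      rw [sweep_succ _ _ _ h1]
      have e : c * sweep c α s i k + α * s (k + 1) - 1
          = c * (sweep c α s i k - 1) + α * s (k + 1) + (c - 1) := by ring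
      rw [e]
      refine norm_add₃_le.trans ?_
      rw [norm_mul, norm_mul]
      have h3 : ‖c - 1‖ ≤ D * d * (E * d) := by
        refine hs.hc.trans ?_
        have h4 : C ≤ D * E := by
          have : C ≤ E := by
            have : 0 ≤ C * T * Real.exp (D * T) + L + K₁ * T := by positivity
            rw [hE]; linarith
          nlinarith [hs.one_le_rate]
        calc C * d ^ 2 ≤ D * E * d ^ 2 := by gcongr
          _ = _ := by ring
      gcongr
      · exact hs.norm_c_le
      · exact hs.norm_α_le
    · have := hs.one_add_pow_le (x := 3) (by norm_num) h2.le
      calc _ ≤ E * d * Real.exp (3 * (D * T)) := by gcongr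
        _ = _ := by rw [hK₂]; ring
  have hrest : 0 ≤ (1 + D * T) * K₁ + C * T * L + D * K₂ + C := by positivity
  refine ⟨(hsw (N - 1) (by omega) (by omega)).trans (by gcongr; linarith), ?_⟩
  intro k h1 h2
  rw [stage_succ, ← hsdef]
  -- Since the sweep is close to 1, the term β · sweep is close to ν̄ d: this is the jump of V by
  -- -ν̄.
  have e : c * s k - β * sweep c α s i (k - 1) - d * (V k - star ν)
      = c * (s k - d * V k) + (c - 1) * (d * V k)
        - (β * (sweep c α s i (k - 1) - 1) + (β - star ν * d)) := by ring
  rw [e]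
  refine (norm_sub_le _ _).trans ((add_le_add (norm_add_le _ _) (norm_add_le _ _)).trans ?_)
  rw [norm_mul, norm_mul, norm_mul, norm_mul, hdn]
  have hcT : ‖c‖ ≤ 1 + D * T := hs.norm_c_le.trans (by gcongr)
  have hcC : ‖c - 1‖ ≤ C * T * d := hs.hc.trans hs.sq_le
  have h3 : ‖c‖ * ‖s k - d * V k‖ ≤ (1 + D * T) * (K₁ * d ^ 2) := by
    gcongr; exact hV k h1 h2
  have h4 : ‖c - 1‖ * (d * ‖V k‖) ≤ C * T * d * (d * L) := by
    gcongr; exact hVL k h1 h2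
  have h5 : ‖β‖ * ‖sweep c α s i (k - 1) - 1‖ ≤ D * d * (K₂ * d) := by
    gcongr
    · exact hs.norm_β_le
    · exact hsw (k - 1) (by omega) (by omega)
  calc _ ≤ (1 + D * T) * (K₁ * d ^ 2) + C * T * d * (d * L) + (D * d * (K₂ * d) + C * d ^ 2) :=
        add_le_add (add_le_add h3 h4) (add_le_add h5 hs.hβ)
    _ = ((1 + D * T) * K₁ + C * T * L + D * K₂ + C) * d ^ 2 := by ring
    _ ≤ _ := mul_le_mul_of_nonneg_right (le_add_of_nonneg_left (by positivity)) (by positivity)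

/-- Rows of the double product, above the diagonal. -/
theorem exists_row_error_above (ν : ℂ) (C T L K₁ : ℝ) (hL : 0 ≤ L) (hK₁ : 0 ≤ K₁) :
    ∃ K : ℝ, ∀ (N : ℕ) (d : ℝ) (c α β : ℂ) (P V : ℕ → ℕ → ℂ) (i : ℕ) (w : ℕ → ℂ),
      StepCoeff ν C T N d c α β → GoursatApprox ν L N d P V → i < N →
      (∀ j, P j j = V j j) →
      (∀ k, i < k → k < N → ‖V (i + 1) k - V i k‖ ≤ L * d) →
      (∀ k, i < k → k < N → ‖stage c α β w (i + 1) k - d * V i k‖ ≤ K₁ * d ^ 2) →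
      ∀ j, i < j → j < N →
        ‖sweep c α (stage c α β w j) j (N - 1) - d * P j (N - 1)‖ ≤ K * d ^ 2 := by
  obtain ⟨K, hK⟩ := exists_goursat_stability ν C T L (K₁ + L) (by positivity)
  refine ⟨K, fun N d c α β P V i w hs ha hi hPV hVi h0 j hij hjN => ?_⟩
  have hd := hs.nonneg
  have hdn : ‖(d : ℂ)‖ = d := by rw [Complex.norm_real, Real.norm_of_nonneg hd]
  -- The scheme restarts at stage i + 1 with every sweep beginning on the diagonal, where it
  -- inherits the stage error because P = V there. The initial data are known at X₀ = i d, and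
  -- moving them to (i + 1) d costs L d.
  refine ((hK N d c α β P V w (i + 1) N id id hs ha le_rfl (fun _ => Nat.le_succ _)
    (fun _ => le_rfl) (fun j hj => ⟨le_rfl, hj⟩) ?_ ?_) j hij).2 hjN (N - 1)
      (Nat.le_sub_one_of_lt hjN) (by omega)
  · intro k hk hkN
    have e : stage c α β w (i + 1) k - d * V (i + 1) k
        = (stage c α β w (i + 1) k - d * V i k) - d * (V (i + 1) k - V i k) := by ring
    rw [e]
    refine (norm_sub_le _ _).trans ?_
    rw [norm_mul, hdn]
    calc _ ≤ K₁ * d ^ 2 + d * (L * d) := by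
          gcongr
          · exact h0 k hk hkN
          · exact hVi k hk hkN
      _ = _ := by ring
  · intro j _ _
    exact Or.inr ⟨le_rfl, rfl, hPV j⟩

/-! ### Solutions of the continuous Goursat problem -/

/-- `F` is bounded by `L` on `[0, T]²` and Lipschitz there with constant `L`. -/
structure LipOnSquare (T L : ℝ) (F : ℝ → ℝ → ℂ) : Prop where
  bound : ∀ X ∈ Set.Icc 0 T, ∀ Z ∈ Set.Icc 0 T, ‖F X Z‖ ≤ L
  lip : ∀ X ∈ Set.Icc 0 T, ∀ Z ∈ Set.Icc 0 T, ∀ X' ∈ Set.Icc 0 T, ∀ Z' ∈ Set.Icc 0 T,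
    ‖F X Z - F X' Z'‖ ≤ L * (|X - X'| + |Z - Z'|)

namespace LipOnSquare

variable {T L L' : ℝ} {F F' : ℝ → ℝ → ℂ}

theorem nonneg (h : LipOnSquare T L F) (hT : 0 ≤ T) : 0 ≤ L :=
  (norm_nonneg _).trans (h.bound 0 ⟨le_rfl, hT⟩ 0 ⟨le_rfl, hT⟩)

theorem mono (h : LipOnSquare T L F) (hL : L ≤ L') : LipOnSquare T L' F :=
  ⟨fun X hX Z hZ => (h.bound X hX Z hZ).trans hL, fun X hX Z hZ X' hX' Z' hZ' =>
    (h.lip X hX Z hZ X' hX' Z' hZ').trans (by gcongr)⟩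

theorem const_mul (h : LipOnSquare T L F) (z : ℂ) :
    LipOnSquare T (‖z‖ * L) fun X Z => z * F X Z := by
  refine ⟨fun X hX Z hZ => ?_, fun X hX Z hZ X' hX' Z' hZ' => ?_⟩
  · rw [norm_mul]; gcongr; exact h.bound X hX Z hZ
  · rw [← mul_sub, norm_mul, mul_assoc]; gcongr; exact h.lip X hX Z hZ X' hX' Z' hZ'

theorem add (h : LipOnSquare T L F) (h' : LipOnSquare T L' F') :
    LipOnSquare T (L + L') fun X Z => F X Z + F' X Z := by
  refine ⟨fun X hX Z hZ => ?_, fun X hX Z hZ X' hX' Z' hZ' => ?_⟩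
  · exact (norm_add_le _ _).trans (add_le_add (h.bound X hX Z hZ) (h'.bound X hX Z hZ))
  · rw [add_sub_add_comm, add_mul]
    exact (norm_add_le _ _).trans
      (add_le_add (h.lip X hX Z hZ X' hX' Z' hZ') (h'.lip X hX Z hZ X' hX' Z' hZ'))

/-- The substitution does not increase ℓ¹ distances before scaling by m, so L bounds the values and
L m is a Lipschitz constant; L (1 + m) covers both. -/
theorem of_lipOnBox {f : ℝ → ℝ → ℂ} {m : ℝ} (hm : 0 ≤ m) (hf : LipOnBox (T * m) L f) (hL : 0 ≤ L)
    {u v : ℝ → ℝ → ℝ} (hu : ∀ X ∈ Set.Icc 0 T, ∀ Z ∈ Set.Icc 0 T, |u X Z| ≤ T)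
    (hv : ∀ X ∈ Set.Icc 0 T, ∀ Z ∈ Set.Icc 0 T, |v X Z| ≤ T)
    (huv : ∀ X Z X' Z', |u X Z - u X' Z'| + |v X Z - v X' Z'| ≤ |X - X'| + |Z - Z'|) :
    LipOnSquare T (L * (1 + m)) fun X Z => f (u X Z * m) (v X Z * m) := by
  have hs : ∀ {x : ℝ}, |x| ≤ T → |x * m| ≤ T * m := fun {x} hx => by
    rw [abs_mul, abs_of_nonneg hm]; gcongr
  refine ⟨fun X hX Z hZ => ?_, fun X hX Z hZ X' hX' Z' hZ' => ?_⟩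
  · refine (hf.1 _ _ (hs (hu X hX Z hZ)) (hs (hv X hX Z hZ))).trans ?_
    exact le_mul_of_one_le_right hL (by linarith)
  · refine (hf.2 _ _ _ _ (hs (hu X hX Z hZ)) (hs (hv X hX Z hZ)) (hs (hu X' hX' Z' hZ'))
      (hs (hv X' hX' Z' hZ'))).trans ?_
    rw [← sub_mul, ← sub_mul, abs_mul, abs_mul, abs_of_nonneg hm, mul_assoc]
    gcongr
    have := huv X Z X' Z'
    have h1 : 0 ≤ |X - X'| + |Z - Z'| := by positivity
    nlinarith

end LipOnSquare

/-- `∂_Z P = ν V` and `∂_X V = -ν̄ P`, with bounds on `[0, T]²`. -/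
structure IsGoursatSolution (ν : ℂ) (T L : ℝ) (P V : ℝ → ℝ → ℂ) : Prop where
  deriv_P : ∀ X Z, HasDerivAt (fun Z => P X Z) (ν * V X Z) Z
  deriv_V : ∀ X Z, HasDerivAt (fun X => V X Z) (-star ν * P X Z) X
  lip_P : LipOnSquare T L P
  lip_V : LipOnSquare T L V

theorem IsGoursatSolution.add {ν : ℂ} {T L L' : ℝ} {P V P' V' : ℝ → ℝ → ℂ}
    (h : IsGoursatSolution ν T L P V) (h' : IsGoursatSolution ν T L' P' V') :
    IsGoursatSolution ν T (L + L') (fun X Z => P X Z + P' X Z) fun X Z => V X Z + V' X Z := by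
  refine ⟨fun X Z => ?_, fun X Z => ?_, h.lip_P.add h'.lip_P, h.lip_V.add h'.lip_V⟩
  · exact ((h.deriv_P X Z).add (h'.deriv_P X Z)).congr_deriv (by ring)
  · exact ((h.deriv_V X Z).add (h'.deriv_V X Z)).congr_deriv (by ring)

theorem norm_increment_sub_le {f f' : ℝ → ℂ} {g : ℂ} {x d M : ℝ} (hd : 0 ≤ d)
    (hf : ∀ z, HasDerivAt f (f' z) z) (hM : ∀ z ∈ Set.Icc x (x + d), ‖f' z - g‖ ≤ M) :
    ‖f (x + d) - f x - d * g‖ ≤ M * d := by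
  have h := (convex_Icc x (x + d)).norm_image_sub_le_of_norm_hasDerivWithin_le
    (f := fun z => f z - z * g) (f' := fun z => f' z - g) (C := M)
    (fun z _ => ((hf z).sub (((hasDerivAt_id z).ofReal_comp.mul_const g).congr_deriv
      (by simp))).hasDerivWithinAt) hM
    (Set.left_mem_Icc.2 (by linarith)) (Set.right_mem_Icc.2 (by linarith))
  have e : f (x + d) - ((x + d : ℝ) : ℂ) * g - (f x - x * g) = f (x + d) - f x - d * g := by
    push_cast; ring
  rwa [e, add_sub_cancel_left, Real.norm_of_nonneg hd] at h

theorem grid_mem {N : ℕ} {d T : ℝ} (hd : 0 ≤ d) (hN : N * d = T) {k : ℕ} (hk : k ≤ N) :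
    (k : ℝ) * d ∈ Set.Icc 0 T := by
  refine ⟨by positivity, ?_⟩
  rw [← hN]
  gcongr

/-- Over a step of length d the derivative differs from the value used by the scheme by O(d), by the
Lipschitz bounds. The factor 2 arises in the V-step, where P is taken at a point shifted in both
variables. -/
theorem IsGoursatSolution.approx {ν : ℂ} {T L : ℝ} {P V : ℝ → ℝ → ℂ}
    (h : IsGoursatSolution ν T L P V) {N : ℕ} {d : ℝ} (hd : 0 ≤ d) (hN : N * d = T) :
    GoursatApprox ν (L * (1 + 2 * ‖ν‖)) N d (fun j k => P (j * d) (k * d))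
      fun j k => V (j * d) (k * d) := by
  have hT : 0 ≤ T := by rw [← hN]; positivity
  have hL := h.lip_P.nonneg hT
  have hL' : L ≤ L * (1 + 2 * ‖ν‖) := le_mul_of_one_le_right hL (by linarith [norm_nonneg ν])
  have hseg : ∀ {k : ℕ} {z : ℝ}, k < N → z ∈ Set.Icc (k * d) (k * d + d) → z ∈ Set.Icc 0 T := by
    intro k z hk hz
    have h1 := (grid_mem hd hN hk.le).1
    have h2 := (grid_mem hd hN (Nat.succ_le_of_lt hk)).2
    push_cast at h2
    exact ⟨h1.trans hz.1, hz.2.trans (by linarith)⟩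
  refine ⟨fun j k hj hk => (h.lip_P.bound _ (grid_mem hd hN hj) _ (grid_mem hd hN hk)).trans hL',
    fun j k hj hk => (h.lip_V.bound _ (grid_mem hd hN hj) _ (grid_mem hd hN hk)).trans hL', ?_, ?_⟩
  · intro j k hj hk
    have hx := grid_mem hd hN hj
    have e : ((k + 1 : ℕ) : ℝ) * d = k * d + d := by push_cast; ring
    have hz1 := grid_mem hd hN (Nat.succ_le_of_lt hk)
    simp only [e] at hz1 ⊢
    rw [mul_assoc]
    refine (norm_increment_sub_le (M := ‖ν‖ * (L * d)) hd (h.deriv_P (j * d)) fun z hz => ?_).trans ?_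
    · rw [← mul_sub, norm_mul]
      have := h.lip_V.lip _ hx z (hseg hk hz) _ hx _ hz1
      rw [sub_self, abs_zero, zero_add] at this
      refine mul_le_mul_of_nonneg_left (this.trans ?_) (norm_nonneg _)
      refine mul_le_mul_of_nonneg_left ?_ hL
      rw [abs_sub_le_iff]; constructor <;> linarith [hz.1, hz.2]
    · have : 0 ≤ L * d ^ 2 := by positivity
      nlinarith [norm_nonneg ν]
  · intro j k hj hk
    have hz := grid_mem hd hN hk.le
    have hx := grid_mem hd hN hj.le
    have e : ((k + 1 : ℕ) : ℝ) * d = k * d + d := by push_cast; ring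
    have e' : ((j + 1 : ℕ) : ℝ) * d = j * d + d := by push_cast; ring
    have hz1 := grid_mem hd hN (Nat.succ_le_of_lt hk)
    simp only [e, e'] at hz1 ⊢
    rw [mul_assoc]
    refine (norm_increment_sub_le (M := ‖ν‖ * (L * (d + d))) hd
      (fun x => h.deriv_V x (k * d + d)) fun x hx' => ?_).trans ?_
    · rw [← mul_sub, norm_mul, norm_neg, norm_star]
      have := h.lip_P.lip x (hseg hj hx') _ hz1 _ hx _ hz
      refine mul_le_mul_of_nonneg_left (this.trans ?_) (norm_nonneg _)
      refine mul_le_mul_of_nonneg_left (add_le_add ?_ ?_) hL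
      · rw [abs_sub_le_iff]; constructor <;> linarith [hx'.1, hx'.2]
      · rw [abs_sub_le_iff]; constructor <;> linarith
    · have : 0 ≤ L * d ^ 2 := by positivity
      nlinarith [norm_nonneg ν]

/-! ### The explicit solutions -/

/-- The solution issuing from the row index `X₀`, before the stage `X₀` is reached. -/
def lowerP (ν : ℂ) (X₀ X Z : ℝ) : ℂ := ν * besselB 0 (X * ‖ν‖) ((Z - X₀) * ‖ν‖)

/-- The companion of `lowerP`. -/
def lowerV (ν : ℂ) (X₀ X Z : ℝ) : ℂ := ‖ν‖ * besselB 1 (X * ‖ν‖) ((Z - X₀) * ‖ν‖)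

/-- The contribution added after the stage `X₀`. -/
def upperP (ν : ℂ) (X₀ X Z : ℝ) : ℂ :=
  ‖ν‖ * besselB 1 (Z * ‖ν‖) ((X - X₀) * ‖ν‖)
    + -(ν + star ν) * besselSum 0 (star ν / ‖ν‖) ((X - X₀) * ‖ν‖) (Z * ‖ν‖)

/-- The companion of `upperP`. -/
def upperV (ν : ℂ) (X₀ X Z : ℝ) : ℂ :=
  -star ν * besselB 0 (Z * ‖ν‖) ((X - X₀) * ‖ν‖)
    + -(ν + star ν) * (star ν / ‖ν‖) *
      besselSum 1 (star ν / ‖ν‖) ((X - X₀) * ‖ν‖) (Z * ‖ν‖)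

theorem norm_phase_le (ν : ℂ) : ‖star ν / (‖ν‖ : ℂ)‖ ≤ 1 := by
  rw [norm_div, norm_star, Complex.norm_real, norm_norm]
  exact div_self_le_one _

theorem norm_mul_phase (ν : ℂ) : (‖ν‖ : ℂ) * (star ν / ‖ν‖) = star ν := by
  by_cases h : ν = 0
  · simp [h]
  · exact mul_div_cancel₀ _ (by simpa using h)

theorem mul_star_eq_norm_sq (ν : ℂ) : ν * star ν = (‖ν‖ : ℂ) * ‖ν‖ := by
  have := RCLike.mul_conj ν
  rw [← sq]
  exact this

theorem mul_phase (ν : ℂ) : ν * (star ν / ‖ν‖) = ‖ν‖ := by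
  by_cases h : ν = 0
  · simp [h]
  · rw [mul_div_assoc', mul_star_eq_norm_sq, mul_div_cancel_right₀]
    simpa using h

/-- The derivative rules raise B_0 to B_1 in Z and lower B_1 to -B_0 in X; the constants match
because |ν|² = ν ν̄. The bound L is uniform in X₀, hence in the row index. -/
theorem exists_lower_isGoursatSolution (ν : ℂ) {T : ℝ} (hT : 0 ≤ T) :
    ∃ L, ∀ X₀ ∈ Set.Icc 0 T, IsGoursatSolution ν T L (lowerP ν X₀) (lowerV ν X₀) := by
  set m : ℝ := ‖ν‖ with hm
  have hm0 : 0 ≤ m := norm_nonneg ν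
  set B := boxBound (T * m)
  have hB : 0 ≤ B := (boxBound_pos _).le
  refine ⟨m * (B * (1 + m)), fun X₀ hX₀ => ⟨?_, ?_, ?_, ?_⟩⟩
  · intro X Z
    have h1 : HasDerivAt (fun Z : ℝ => (Z - X₀) * m) m Z := by
      simpa using ((hasDerivAt_id Z).sub_const X₀).mul_const m
    have h2 := (((hasDerivAt_besselB_right 0 (X * m) ((Z - X₀) * m)).comp Z h1).ofReal_comp).const_mul ν
    refine h2.congr_deriv ?_
    simp only [lowerV, ← hm]
    push_cast; ring
  · intro X Z
    have h1 : HasDerivAt (fun X : ℝ => X * m) m X := by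
      simpa using (hasDerivAt_id X).mul_const m
    have h2 := (((hasDerivAt_besselB_succ_left 0 (X * m) ((Z - X₀) * m)).comp X h1).ofReal_comp).const_mul
      (m : ℂ)
    refine h2.congr_deriv ?_
    simp only [lowerP, ← hm]
    have := mul_star_eq_norm_sq ν
    rw [← hm] at this
    push_cast
    linear_combination (besselB 0 (X * m) ((Z - X₀) * m) : ℂ) * this
  · exact (LipOnSquare.of_lipOnBox hm0 (lipOnBox_besselB_zero (T * m)) hB (u := fun X _ => X)
      (v := fun _ Z => Z - X₀) (fun X hX _ _ => abs_le.2 ⟨by linarith [hX.1], hX.2⟩)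
      (fun _ _ Z hZ => abs_le.2 ⟨by linarith [hZ.1, hX₀.2], by linarith [hX₀.1, hZ.2]⟩)
      (fun X Z X' Z' => by simp)).const_mul ν
  · have := (LipOnSquare.of_lipOnBox hm0 (lipOnBox_besselB_succ (T * m) 0) hB (u := fun X _ => X)
      (v := fun _ Z => Z - X₀) (fun X hX _ _ => abs_le.2 ⟨by linarith [hX.1], hX.2⟩)
      (fun _ _ Z hZ => abs_le.2 ⟨by linarith [hZ.1, hX₀.2], by linarith [hX₀.1, hZ.2]⟩)
      (fun X Z X' Z' => by simp)).const_mul (m : ℂ)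
    rwa [Complex.norm_real, Real.norm_of_nonneg hm0] at this

/-- With ω = ν̄/|ν|, the system follows from the derivative rules together with |ν| ω = ν̄, ν ω =
|ν| and |ν|² = ν ν̄. All three survive ν = 0 with division by zero equal to zero. -/
theorem exists_upper_isGoursatSolution (ν : ℂ) {T : ℝ} (hT : 0 ≤ T) :
    ∃ L, ∀ X₀ ∈ Set.Icc 0 T, IsGoursatSolution ν T L (upperP ν X₀) (upperV ν X₀) := by
  set m : ℝ := ‖ν‖ with hm
  have hm0 : 0 ≤ m := norm_nonneg ν
  set B := boxBound (T * m)
  have hB : 0 ≤ B := (boxBound_pos _).le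
  set ω : ℂ := star ν / ‖ν‖
  have hω : ‖ω‖ ≤ 1 := norm_phase_le ν
  have hmω : (m : ℂ) * ω = star ν := norm_mul_phase ν
  have hνω : ν * ω = m := mul_phase ν
  have hνν := mul_star_eq_norm_sq ν
  rw [← hm] at hνν
  set L₁ := ‖(m : ℂ)‖ * (B * (1 + m)) + ‖-(ν + star ν)‖ * (2 * B * (1 + m))
  set L₂ := ‖-star ν‖ * (B * (1 + m)) + ‖-(ν + star ν) * ω‖ * (B * (1 + m))
  refine ⟨max L₁ L₂, fun X₀ hX₀ => ⟨?_, ?_, ?_, ?_⟩⟩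
  · intro X Z
    have h1 : HasDerivAt (fun Z : ℝ => Z * m) m Z := by
      simpa using (hasDerivAt_id Z).mul_const m
    have h2 := (((hasDerivAt_besselB_succ_left 0 (Z * m) ((X - X₀) * m)).comp Z h1).ofReal_comp).const_mul
      (m : ℂ)
    have h3 := ((hasDerivAt_besselSum_right hω 0 ((X - X₀) * m) (Z * m)).scomp Z h1).const_mul
      (-(ν + star ν))
    refine (h2.add h3).congr_deriv ?_
    simp only [upperV, ← hm, zero_add, Complex.real_smul]
    push_cast
    linear_combination (besselB 0 (Z * m) ((X - X₀) * m) : ℂ) * hνν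
      + (ν + star ν) * besselSum 1 ω ((X - X₀) * m) (Z * m) * hνω
  · intro X Z
    have h1 : HasDerivAt (fun X : ℝ => (X - X₀) * m) m X := by
      simpa using ((hasDerivAt_id X).sub_const X₀).mul_const m
    have h2 := (((hasDerivAt_besselB_right 0 (Z * m) ((X - X₀) * m)).comp X h1).ofReal_comp).const_mul
      (-star ν)
    have h3 := ((hasDerivAt_besselSum_succ_left hω 0 ((X - X₀) * m) (Z * m)).scomp X h1).const_mul
      (-(ν + star ν) * ω)
    refine (h2.add h3).congr_deriv ?_
    simp only [upperP, ← hm, zero_add, Complex.real_smul]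
    push_cast
    linear_combination (ν + star ν) * besselSum 0 ω ((X - X₀) * m) (Z * m) * hmω
  · refine LipOnSquare.mono (L := L₁) ?_ (le_max_left _ _)
    exact ((LipOnSquare.of_lipOnBox hm0 (lipOnBox_besselB_succ (T * m) 0) hB (u := fun _ Z => Z)
      (v := fun X _ => X - X₀) (fun _ _ Z hZ => abs_le.2 ⟨by linarith [hZ.1], hZ.2⟩)
      (fun X hX _ _ => abs_le.2 ⟨by linarith [hX.1, hX₀.2], by linarith [hX₀.1, hX.2]⟩)
      (fun X Z X' Z' => by simp [add_comm])).const_mul (m : ℂ)).add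
      ((LipOnSquare.of_lipOnBox hm0 (lipOnBox_besselSum_zero (T * m) hω) (by positivity)
      (u := fun X _ => X - X₀) (v := fun _ Z => Z)
      (fun X hX _ _ => abs_le.2 ⟨by linarith [hX.1, hX₀.2], by linarith [hX₀.1, hX.2]⟩)
      (fun _ _ Z hZ => abs_le.2 ⟨by linarith [hZ.1], hZ.2⟩)
      (fun X Z X' Z' => by simp)).const_mul (-(ν + star ν)))
  · refine LipOnSquare.mono (L := L₂) ?_ (le_max_right _ _)
    exact ((LipOnSquare.of_lipOnBox hm0 (lipOnBox_besselB_zero (T * m)) hB (u := fun _ Z => Z)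
      (v := fun X _ => X - X₀) (fun _ _ Z hZ => abs_le.2 ⟨by linarith [hZ.1], hZ.2⟩)
      (fun X hX _ _ => abs_le.2 ⟨by linarith [hX.1, hX₀.2], by linarith [hX₀.1, hX.2]⟩)
      (fun X Z X' Z' => by simp [add_comm])).const_mul (-star ν)).add
      ((LipOnSquare.of_lipOnBox hm0 (lipOnBox_besselSum_succ (T * m) hω 0) hB
      (u := fun X _ => X - X₀) (v := fun _ Z => Z)
      (fun X hX _ _ => abs_le.2 ⟨by linarith [hX.1, hX₀.2], by linarith [hX₀.1, hX.2]⟩)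
      (fun _ _ Z hZ => abs_le.2 ⟨by linarith [hZ.1], hZ.2⟩)
      (fun X Z X' Z' => by simp)).const_mul (-(ν + star ν) * ω))

theorem lowerV_zero (ν : ℂ) (X₀ Z : ℝ) : lowerV ν X₀ 0 Z = 0 := by
  simp [lowerV, besselB_succ_zero_left 0]

theorem lowerP_self (ν : ℂ) (X₀ X : ℝ) : lowerP ν X₀ X X₀ = ν := by
  simp [lowerP, besselB_zero_zero_right]

theorem upperV_self (ν : ℂ) (X₀ Z : ℝ) : upperV ν X₀ X₀ Z = -star ν := by
  simp [upperV, besselB_zero_zero_right, besselSum_succ_zero_left 0]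

/-- Splitting off the term q = 0 of the sum changes the coefficient of B_0 from ν to ν - (ν + ν̄) =
-ν̄, as required for V. This is why ν + ν̄ multiplies the sum in the kernel. -/
theorem lower_add_upper_diag (ν : ℂ) (X₀ X : ℝ) :
    lowerP ν X₀ X X + upperP ν X₀ X X = lowerV ν X₀ X X + upperV ν X₀ X X := by
  have h := besselSum_zero_eq (norm_phase_le ν) ((X - X₀) * ‖ν‖) (X * ‖ν‖)
  rw [lowerP, lowerV, upperP, upperV, h, besselB_zero_comm ((X - X₀) * ‖ν‖)]
  ring

theorem kernelLower_eq (a b : ℝ) (ν : ℂ) (x y : ℝ) :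
    kernelLower a b ν x y = lowerP ν (x - a) (y - a) (b - a) := by
  rw [kernelLower, lowerP]
  congr 4
  ring

theorem kernelUpper_eq (a b : ℝ) (ν : ℂ) (x y : ℝ) :
    kernelUpper a b ν x y
      = lowerP ν (x - a) (y - a) (b - a) + upperP ν (x - a) (y - a) (b - a) := by
  rw [← kernelLower_eq, kernelUpper, upperP, kernelLower, besselSum]
  simp only [add_zero, sub_sub_sub_cancel_right]
  ring

/-! ### The entries of the double products -/

theorem kernel_of_lt {a b : ℝ} {x y : ℝ} (ν : ℂ) (hx : a ≤ x) (hxy : x < y) (hy : y < b) :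
    kernel a b ν x y = kernelUpper a b ν x y := by
  rw [kernel, if_pos ⟨hx, hxy, hy⟩, if_neg (fun h => absurd h.2.1 hxy.not_gt), add_zero]

theorem kernel_of_gt {a b : ℝ} {x y : ℝ} (ν : ℂ) (hy : a ≤ y) (hxy : y < x) (hx : x < b) :
    kernel a b ν x y = kernelLower a b ν x y := by
  rw [kernel, if_neg (fun h => absurd h.2.1 hxy.not_gt), if_pos ⟨hy, hxy, hx⟩, zero_add]

theorem kernel_self (a b : ℝ) (ν : ℂ) (x : ℝ) : kernel a b ν x x = 0 := by
  simp [kernel]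

theorem exists_kernel_bound (a b : ℝ) (ν : ℂ) : ∃ L, ∀ x y, ‖kernel a b ν x y‖ ≤ L := by
  rcases lt_or_ge a b with hab | hab
  swap
  · refine ⟨0, fun x y => ?_⟩
    rw [kernel, if_neg (by rintro ⟨h1, h2, h3⟩; linarith),
      if_neg (by rintro ⟨h1, h2, h3⟩; linarith)]
    simp
  have hT : 0 ≤ b - a := by linarith
  obtain ⟨L₁, h₁⟩ := exists_lower_isGoursatSolution ν hT
  obtain ⟨L₂, h₂⟩ := exists_upper_isGoursatSolution ν hT
  have mem : ∀ {x}, a ≤ x → x < b → x - a ∈ Set.Icc 0 (b - a) :=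
    fun {x} h h' => ⟨by linarith, by linarith⟩
  have hb : b - a ∈ Set.Icc 0 (b - a) := ⟨hT, le_rfl⟩
  have hL₁ := (h₁ _ hb).lip_P.nonneg hT
  have hL₂ := (h₂ _ hb).lip_P.nonneg hT
  refine ⟨L₁ + L₂, fun x y => ?_⟩
  rcases lt_trichotomy x y with hxy | hxy | hxy
  · by_cases h : a ≤ x ∧ y < b
    · rw [kernel_of_lt ν h.1 hxy h.2, kernelUpper_eq]
      have hx := mem h.1 (hxy.trans h.2)
      exact ((h₁ _ hx).add (h₂ _ hx)).lip_P.bound _ (mem (h.1.trans hxy.le) h.2) _ hb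
    · rw [kernel, if_neg (fun h' => h ⟨h'.1, h'.2.2⟩), if_neg (fun h' => absurd h'.2.1 hxy.not_gt)]
      simp only [add_zero, norm_zero]; positivity
  · subst hxy; rw [kernel_self]; simp only [norm_zero]; positivity
  · by_cases h : a ≤ y ∧ x < b
    · rw [kernel_of_gt ν h.1 hxy h.2, kernelLower_eq]
      have hx := mem (h.1.trans hxy.le) h.2
      exact ((h₁ _ hx).lip_P.bound _ (mem h.1 (hxy.trans h.2)) _ hb).trans (by linarith)
    · rw [kernel, if_neg (fun h' => absurd h'.2.1 hxy.not_gt), if_neg (fun h' => h ⟨h'.1, h'.2.2⟩)]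
      simp only [add_zero, norm_zero]; positivity

/-- The entries of the double product are `d` times the kernel on the grid, up to second order. -/
theorem exists_entry_bound {a b : ℝ} (hab : a < b) (ν : ℂ) (C : ℝ) (hC : 0 ≤ C) :
    ∃ K, 0 ≤ K ∧ ∀ (N : ℕ) (d : ℝ) (c α β : ℂ), StepCoeff ν C (b - a) N d c α β → ∀ i j : Fin N,
      (i ≠ j → ‖orderedProd (planeStep (N := N) c α β) i j
        - d * kernel a b ν (a + (i : ℕ) * d) (a + (j : ℕ) * d)‖ ≤ K * d ^ 2) ∧
      (i = j → ‖orderedProd (planeStep (N := N) c α β) i j - 1‖ ≤ K * d) := by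
  set T := b - a with hTdef
  have hT : 0 ≤ T := by rw [hTdef]; linarith
  obtain ⟨L₁, h₁⟩ := exists_lower_isGoursatSolution ν hT
  obtain ⟨L₂, h₂⟩ := exists_upper_isGoursatSolution ν hT
  have hTm : T ∈ Set.Icc 0 T := ⟨hT, le_rfl⟩
  have hL₁ := (h₁ _ hTm).lip_P.nonneg hT
  have hL₂ := (h₂ _ hTm).lip_P.nonneg hT
  set L₃ := L₁ + L₂ with hL₃def
  have hL₃ : 0 ≤ L₃ := by positivity
  set A₁ := L₁ * (1 + 2 * ‖ν‖)
  set A₃ := L₃ * (1 + 2 * ‖ν‖)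
  obtain ⟨K₁, hK₁⟩ := exists_row_error_below ν C T A₁ hC hT
  obtain ⟨K₂, hK₂0, hK₂⟩ := exists_row_error_diag ν C T A₁ (max K₁ 0) hC hT (by positivity)
    (le_max_right _ _)
  obtain ⟨K₃, hK₃⟩ := exists_row_error_above ν C T A₃ K₂ (by positivity) hK₂0
  -- L₃ pays for replacing the last grid value Z = T - d by Z = T; K₂ serves the diagonal entries.
  refine ⟨max (max K₁ K₃ + L₃) K₂, hK₂0.trans (le_max_right _ _), ?_⟩
  intro N d c α β hs i j
  have hd := hs.nonneg
  have hN := hs.mul_eq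
  have hdn : ‖(d : ℂ)‖ = d := by rw [Complex.norm_real, Real.norm_of_nonneg hd]
  have hX₀ := grid_mem hd hN i.2.le
  have S₁ := h₁ _ hX₀
  have S₃ := S₁.add (h₂ _ hX₀)
  have ap₁ := S₁.approx hd hN
  have ap₃ := S₃.approx hd hN
  obtain ⟨r₁, r₂⟩ := hK₁ N d c α β _ _ i hs ap₁ i.2 (fun k => by simp [lowerV_zero])
    (fun j => lowerP_self _ _ _)
  obtain ⟨r₃, r₄⟩ := hK₂ N d c α β _ i hs i.2 (fun k _ hk => ap₁.bound_V i k i.2.le hk.le)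
    (fun k h h' => (r₁ k h h').trans (by gcongr; exact le_max_left _ _))
  have r₅ := hK₃ N d c α β _ _ i (Pi.single (i : ℕ) 1) hs ap₃ i.2
    (fun j => lower_add_upper_diag _ _ _) (fun k _ hk => by
      have hi := grid_mem hd hN (Nat.succ_le_of_lt i.2)
      have hz := grid_mem hd hN hk.le
      refine (S₃.lip_V.lip _ hi _ hz _ hX₀ _ hz).trans ?_
      have e : ((i : ℕ) + 1 : ℕ) * d - (i : ℕ) * d = d := by push_cast; ring
      rw [e, sub_self, abs_zero, add_zero, abs_of_nonneg hd]
      gcongr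
      exact le_mul_of_one_le_right hL₃ (by linarith [norm_nonneg ν]))
    (fun k h h' => by
      have := r₄ k h h'
      -- At X = X₀ the added part of V is exactly the jump -ν̄ found in the diagonal estimate.
      rw [upperV_self, ← sub_eq_add_neg]
      exact this)
  have hdpos : 0 < d := by
    refine hd.lt_of_ne fun h => ?_
    rw [← h, mul_zero] at hN
    linarith
  have hgridlt : ∀ {k : ℕ}, k < N → a + k * d < b := by
    intro k hk
    have h1 : (k : ℝ) * d < N * d := by gcongr
    linarith
  have hgridge : ∀ k : ℕ, a ≤ a + k * d := fun k => by
    have : 0 ≤ (k : ℝ) * d := by positivity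
    linarith
  have hj := grid_mem hd hN j.2.le
  have hlast := grid_mem hd hN (Nat.sub_le N 1)
  -- The sweep ends at index N - 1, one mesh width before T, whereas the kernel takes P at Z = T.
  have hlastT : |((N - 1 : ℕ) : ℝ) * d - T| = d := by
    rw [← hN, Nat.cast_pred hs.pos, ← sub_mul, sub_sub_cancel_left, neg_one_mul, abs_neg,
      abs_of_nonneg hd]
  have finish : ∀ {s p k : ℂ} {K L : ℝ}, ‖s - d * p‖ ≤ K * d ^ 2 → ‖p - k‖ ≤ L * d →
      ‖s - d * k‖ ≤ (K + L) * d ^ 2 := by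
    intro s p k K L hsp hpk
    have e : s - d * k = (s - d * p) + d * (p - k) := by ring
    rw [e]
    refine (norm_add_le _ _).trans ?_
    rw [norm_mul, hdn]
    calc _ ≤ K * d ^ 2 + d * (L * d) := by gcongr
      _ = _ := by ring
  refine ⟨fun hij => ?_, fun hij => ?_⟩
  · rw [orderedProd_planeStep_apply]
    rcases lt_or_gt_of_ne hij with hlt | hlt
    · have hgl : a + (i : ℕ) * d < a + (j : ℕ) * d := by
        have : ((i : ℕ) : ℝ) < (j : ℕ) := by exact_mod_cast hlt
        gcongr
      rw [kernel_of_lt ν (hgridge i) hgl (hgridlt j.2), kernelUpper_eq, ← hTdef,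
        add_sub_cancel_left, add_sub_cancel_left]
      have hp := S₃.lip_P.lip _ hj _ hlast _ hj _ hTm
      rw [sub_self, abs_zero, zero_add, hlastT] at hp
      refine (finish (r₅ j hlt j.2) hp).trans ?_
      gcongr
      exact (by gcongr; exact le_max_right _ _ : K₃ + L₃ ≤ max K₁ K₃ + L₃).trans (le_max_left _ _)
    · have hgl : a + (j : ℕ) * d < a + (i : ℕ) * d := by
        have : ((j : ℕ) : ℝ) < (i : ℕ) := by exact_mod_cast hlt
        gcongr
      rw [kernel_of_gt ν (hgridge j) hgl (hgridlt i.2), kernelLower_eq, ← hTdef,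
        add_sub_cancel_left, add_sub_cancel_left]
      have hp := S₁.lip_P.lip _ hj _ hlast _ hj _ hTm
      rw [sub_self, abs_zero, zero_add, hlastT] at hp
      refine (finish (r₂ j hlt) hp).trans ?_
      gcongr
      refine (add_le_add (le_max_left _ _) ?_ : K₁ + L₁ ≤ max K₁ K₃ + L₃).trans (le_max_left _ _)
      rw [hL₃def]; linarith
  · subst hij
    rw [orderedProd_planeStep_apply]
    exact r₃.trans (by gcongr; exact le_max_right _ _)

/-! ### The coefficients of the two products -/

theorem mesh_nonneg {a b : ℝ} (hab : a < b) (N : ℕ) : 0 ≤ mesh a b N :=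
  div_nonneg (by linarith) (Nat.cast_nonneg N)

theorem mul_mesh (a b : ℝ) {N : ℕ} (hN : 1 ≤ N) : N * mesh a b N = b - a :=
  mul_div_cancel₀ _ (by positivity)

theorem mesh_le {a b : ℝ} (hab : a < b) {N : ℕ} (hN : 1 ≤ N) : mesh a b N ≤ b - a :=
  div_le_self (by linarith) (by exact_mod_cast hN)

theorem stepCoeff_linearized {a b : ℝ} (hab : a < b) (ν : ℂ) {C : ℝ} (hC : 0 ≤ C) {N : ℕ}
    (hN : 1 ≤ N) : StepCoeff ν C (b - a) N (mesh a b N) 1 (mesh a b N * ν) (mesh a b N * star ν) := by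
  have h : 0 ≤ C * mesh a b N ^ 2 := by positivity
  refine ⟨hN, mesh_nonneg hab N, hC, mul_mesh a b hN, ?_, ?_, ?_⟩
  · simpa using h
  · rw [mul_comm, sub_self, norm_zero]; exact h
  · rw [mul_comm, sub_self, norm_zero]; exact h

theorem abs_sin_sub_le {x : ℝ} (hx : 0 ≤ x) : |Real.sin x - x| ≤ x ^ 3 := by
  rcases hx.eq_or_lt with rfl | hx
  · simp
  have h1 := Real.sin_lt hx
  have h2 := Real.sin_gt_sub_cube hx
  have : 0 ≤ x ^ 3 := by positivity
  rw [abs_le]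
  constructor <;> linarith

/-- The cubic error of sin x ≈ x at x = d m, with one factor d bounded by T, gives an O(d²) error
uniform in N. -/
theorem norm_phase_sin_sub_le {κ : ℂ} {m d T : ℝ} (hκ : ‖κ‖ = m) (hd : 0 ≤ d) (hdT : d ≤ T) :
    ‖κ / m * Real.sin (d * m) - κ * d‖ ≤ T * m ^ 3 * d ^ 2 := by
  have hm : 0 ≤ m := hκ ▸ norm_nonneg κ
  have e : κ / m * Real.sin (d * m) - κ * d = κ / m * ((Real.sin (d * m) - d * m : ℝ) : ℂ) := by
    rcases hm.eq_or_lt with h | h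
    · have : κ = 0 := norm_eq_zero.1 (hκ.trans h.symm)
      simp [this]
    · have h' : (m : ℂ) ≠ 0 := by exact_mod_cast h.ne'
      push_cast
      field_simp
  rw [e, norm_mul, Complex.norm_real, Real.norm_eq_abs]
  have h1 : ‖κ / (m : ℂ)‖ ≤ 1 := by
    rw [norm_div, Complex.norm_real, Real.norm_of_nonneg hm, hκ]
    exact div_self_le_one _
  calc _ ≤ 1 * (d * m) ^ 3 := by
        gcongr
        exact abs_sin_sub_le (by positivity)
    _ = d * m ^ 3 * d ^ 2 := by ring
    _ ≤ _ := by gcongr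

theorem stepCoeff_rotation {a b : ℝ} (hab : a < b) (ν : ℂ) {N : ℕ} (hN : 1 ≤ N) :
    StepCoeff ν (‖ν‖ ^ 2 / 2 + (b - a) * ‖ν‖ ^ 3) (b - a) N (mesh a b N)
      (Real.cos (mesh a b N * ‖ν‖) : ℂ) (ν / ‖ν‖ * Real.sin (mesh a b N * ‖ν‖))
      (star ν / ‖ν‖ * Real.sin (mesh a b N * ‖ν‖)) := by
  have hT : 0 ≤ b - a := by linarith
  have hd := mesh_nonneg hab N
  have hdT := mesh_le hab hN
  have h1 : 0 ≤ ‖ν‖ ^ 2 / 2 := by positivity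
  have h2 : 0 ≤ (b - a) * ‖ν‖ ^ 3 := by positivity
  refine ⟨hN, hd, by positivity, mul_mesh a b hN, ?_, ?_, ?_⟩
  · rw [← Complex.ofReal_one, ← Complex.ofReal_sub, Complex.norm_real, Real.norm_eq_abs, abs_sub_comm,
      abs_of_nonneg (by linarith [Real.cos_le_one (mesh a b N * ‖ν‖)])]
    have := Real.one_sub_sq_div_two_le_cos (x := mesh a b N * ‖ν‖)
    have h3 : 0 ≤ (b - a) * ‖ν‖ ^ 3 * mesh a b N ^ 2 := by positivity
    nlinarith
  · refine (norm_phase_sin_sub_le rfl hd hdT).trans ?_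
    gcongr
    linarith
  · refine (norm_phase_sin_sub_le (norm_star ν) hd hdT).trans ?_
    gcongr
    linarith

/-- Matrices whose entries approximate the values of the kernel on the grid. -/
def ApproximatesKernel (a b : ℝ) (ν : ℂ) (M : (N : ℕ) → Matrix (Fin N) (Fin N) ℂ) : Prop :=
  ∃ K, 0 ≤ K ∧ ∀ N : ℕ, 1 ≤ N → ∀ i j : Fin N,
    (i ≠ j → ‖M N i j - mesh a b N * kernel a b ν (a + (i : ℕ) * mesh a b N)
      (a + (j : ℕ) * mesh a b N)‖ ≤ K * mesh a b N ^ 2) ∧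
    (i = j → ‖M N i j - 1‖ ≤ K * mesh a b N)

theorem approximatesKernel_rotation {a b : ℝ} (hab : a < b) (ν : ℂ) :
    ApproximatesKernel a b ν fun N => orderedProd (rotation a b ν N) := by
  have hT : 0 ≤ b - a := by linarith
  obtain ⟨K, hK0, hK⟩ := exists_entry_bound hab ν (‖ν‖ ^ 2 / 2 + (b - a) * ‖ν‖ ^ 3) (by positivity)
  refine ⟨K, hK0, fun N hN => ?_⟩
  simp only [rotation_eq_planeStep]
  exact hK N _ _ _ _ (stepCoeff_rotation hab ν hN)

theorem approximatesKernel_linearized {a b : ℝ} (hab : a < b) (ν : ℂ) :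
    ApproximatesKernel a b ν fun N => orderedProd (linearized a b ν N) := by
  obtain ⟨K, hK0, hK⟩ := exists_entry_bound hab ν 0 le_rfl
  refine ⟨K, hK0, fun N hN => ?_⟩
  simp only [linearized_eq_planeStep]
  exact hK N _ _ _ _ (stepCoeff_linearized hab ν le_rfl hN)

/-! ### Unitarity of the rotation products -/

/-- On rows, the second factor undoes the first in the (j, k)-plane up to the determinant c² + αβ,
which is 1. -/
theorem planeStep_mul_planeStep_neg {N : ℕ} {c α β : ℂ} (h : c * c + α * β = 1) {j k : Fin N}
    (hjk : j ≠ k) : planeStep c α β j k * planeStep c (-α) (-β) j k = 1 := by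
  apply Matrix.ext_of_single_vecMul
  intro i
  rw [← Matrix.vecMul_vecMul, Matrix.vecMul_one]
  funext l
  rw [vecMul_planeStep _ _ _ hjk]
  simp only [vecMul_planeStep _ _ _ hjk, if_true, if_neg hjk.symm]
  split_ifs with h1 h2
  · subst h1; linear_combination (Pi.single i (1 : ℂ) : Fin N → ℂ) l * h
  · subst h2; linear_combination (Pi.single i (1 : ℂ) : Fin N → ℂ) l * h
  · rfl

theorem star_planeStep {N : ℕ} (c α β : ℂ) (j k : Fin N) :
    star (planeStep c α β j k) = planeStep (star c) (-star β) (-star α) j k := by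
  simp only [planeStep, Matrix.star_eq_conjTranspose, Matrix.conjTranspose_add,
    Matrix.conjTranspose_sub, Matrix.conjTranspose_smul, Matrix.conjTranspose_one,
    Matrix.conjTranspose_single, star_sub, star_one, neg_smul]
  abel

theorem rotation_mem_unitary (a b : ℝ) (ν : ℂ) {N : ℕ} {j k : Fin N} (hjk : j ≠ k) :
    rotation a b ν N j k ∈ unitary (Matrix (Fin N) (Fin N) ℂ) := by
  rw [rotation_eq_planeStep]
  set s : ℝ := Real.sin (mesh a b N * ‖ν‖) with hs
  set c : ℝ := Real.cos (mesh a b N * ‖ν‖) with hc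
  have hsc : (c : ℂ) * c + s * s = 1 := by
    have := Real.cos_sq_add_sin_sq (mesh a b N * ‖ν‖)
    rw [← hs, ← hc] at this
    exact_mod_cast (by linarith : c * c + s * s = 1)
  -- For ν = 0 the phases are 0 by convention, but the sine vanishes as well.
  have hαβ : ν / ‖ν‖ * s * (star ν / ‖ν‖ * s) = (s : ℂ) * s := by
    by_cases hν : ν = 0
    · simp [hs, hν]
    · have h0 : (‖ν‖ : ℂ) ≠ 0 := by simpa using hν
      have := mul_star_eq_norm_sq ν
      field_simp
      linear_combination s ^ 2 * this
  have hstar : star (planeStep (N := N) (c : ℂ) (ν / ‖ν‖ * s) (star ν / ‖ν‖ * s) j k)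
      = planeStep (c : ℂ) (-(ν / ‖ν‖ * s)) (-(star ν / ‖ν‖ * s)) j k := by
    rw [star_planeStep]
    simp
  refine ⟨?_, ?_⟩
  · rw [hstar]
    have := planeStep_mul_planeStep_neg (c := (c : ℂ)) (α := -(ν / ‖ν‖ * s))
      (β := -(star ν / ‖ν‖ * s)) (by rw [neg_mul_neg, hαβ, hsc]) hjk
    rwa [neg_neg, neg_neg] at this
  · rw [hstar]
    exact planeStep_mul_planeStep_neg (by rw [hαβ, hsc]) hjk

theorem orderedProd_rotation_mem_unitary (a b : ℝ) (ν : ℂ) (N : ℕ) :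
    orderedProd (rotation a b ν N) ∈ unitary (Matrix (Fin N) (Fin N) ℂ) := by
  refine Submonoid.list_prod_mem _ fun x hx => ?_
  obtain ⟨j, -, rfl⟩ := List.mem_map.1 hx
  refine Submonoid.list_prod_mem _ fun x hx => ?_
  obtain ⟨k, hk, rfl⟩ := List.mem_map.1 hx
  have : j < k := by simpa using (List.mem_filter.1 hk).2
  exact rotation_mem_unitary a b ν this.ne

/-! ### Matrices as operators -/

/-- The cell `[a + jΔ, a + (j + 1)Δ)` of the equipartition. -/
abbrev cell (a b : ℝ) (N j : ℕ) : Set ℝ :=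
  Set.Ico (a + j * mesh a b N) (a + ((j : ℝ) + 1) * mesh a b N)

theorem cell_disjoint {a b : ℝ} (hab : a < b) {N j k : ℕ} (hjk : j < k) :
    Disjoint (cell a b N j) (cell a b N k) := by
  rw [Set.disjoint_left]
  intro x hx hx'
  have h1 : (j : ℝ) + 1 ≤ k := by exact_mod_cast hjk
  have := mul_le_mul_of_nonneg_right h1 (mesh_nonneg hab N)
  linarith [hx.2, hx'.1]

theorem cell_subset {a b : ℝ} (hab : a < b) {N j : ℕ} (hj : j < N) :
    cell a b N j ⊆ Set.Ico a b := by
  have h0 := mesh_nonneg hab N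
  have hN := mul_mesh a b (show 1 ≤ N by omega)
  have h1 : (j : ℝ) + 1 ≤ N := by exact_mod_cast hj
  have h2 := mul_le_mul_of_nonneg_right h1 h0
  have h3 : 0 ≤ (j : ℝ) * mesh a b N := by positivity
  exact Set.Ico_subset_Ico (by linarith) (by linarith)

theorem orthonormal_chi {a b : ℝ} (hab : a < b) (N : ℕ) : Orthonormal ℂ (chi a b N) := by
  have hba : 0 < b - a := by linarith
  rw [orthonormal_iff_ite]
  intro j k
  rw [chi, chi, L2.inner_indicatorConstLp_indicatorConstLp]
  split_ifs with h
  · subst h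
    have hN : 1 ≤ N := by have := j.2; omega
    have hN0 : (0 : ℝ) < N := by exact_mod_cast hN
    have hv : (vol a b).real (cell a b N j) = mesh a b N := by
      rw [measureReal_restrict_apply measurableSet_Ico,
        Set.inter_eq_left.2 (cell_subset hab j.2), Real.volume_real_Ico_of_le]
      · ring
      · linarith [mesh_nonneg hab N]
    rw [Set.inter_self, hv]
    have hi : inner ℂ ((√(N / (b - a)) : ℝ) : ℂ) ((√(N / (b - a)) : ℝ) : ℂ)
        = ((N / (b - a) : ℝ) : ℂ) := by
      rw [RCLike.inner_apply, Complex.conj_ofReal, ← Complex.ofReal_mul,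
        Real.mul_self_sqrt (by positivity)]
    rw [hi, Complex.real_smul, ← Complex.ofReal_mul, mesh, div_mul_div_cancel₀ hN0.ne',
      div_self hba.ne', Complex.ofReal_one]
  · have hne : (j : ℕ) ≠ k := fun h' => h (Fin.ext h')
    have hd : Disjoint (cell a b N j) (cell a b N k) := by
      rcases lt_or_gt_of_ne hne with h | h
      · exact cell_disjoint hab h
      · exact (cell_disjoint hab h).symm
    rw [Set.disjoint_iff_inter_eq_empty.1 hd]
    simp

/-! ### Finite-rank operators with a given matrix in an orthonormal family -/

section MatrixOperator

variable {E : Type*} [NormedAddCommGroup E] [InnerProductSpace ℂ E] {n : Type*}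

open InnerProductSpace

variable [Fintype n]

/-- The operator which acts as the matrix `A` on the span of `v` and as zero on its complement. -/
def matrixOp (v : n → E) (A : Matrix n n ℂ) : E →L[ℂ] E :=
  ∑ j, ∑ k, A j k • rankOne ℂ (v j) (v k)

theorem matrixOp_add (v : n → E) (A B : Matrix n n ℂ) :
    matrixOp v (A + B) = matrixOp v A + matrixOp v B := by
  simp [matrixOp, add_smul, Finset.sum_add_distrib]

/-- Orthonormality makes the rank-one operators |v_j⟩⟨v_k| multiply like matrix units. -/
theorem matrixOp_mul {v : n → E} (hv : Orthonormal ℂ v) (A B : Matrix n n ℂ) :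
    matrixOp v (A * B) = matrixOp v A * matrixOp v B := by
  classical
  have h : ∀ j k l m, (rankOne ℂ (v j) (v k) : E →L[ℂ] E) * rankOne ℂ (v l) (v m)
      = if k = l then rankOne ℂ (v j) (v m) else 0 := by
    intro j k l m
    rw [ContinuousLinearMap.mul_def, rankOne_comp_rankOne, orthonormal_iff_ite.1 hv k l]
    split_ifs <;> simp
  simp_rw [matrixOp, Finset.sum_mul, Finset.mul_sum, smul_mul_smul_comm, h, Matrix.mul_apply,
    Finset.sum_smul, smul_ite, smul_zero]
  refine Finset.sum_congr rfl fun j _ => ?_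
  rw [Finset.sum_comm]
  refine Finset.sum_congr rfl fun k _ => ?_
  rw [Finset.sum_comm]
  simp

theorem star_matrixOp [CompleteSpace E] (v : n → E) (A : Matrix n n ℂ) :
    star (matrixOp v A) = matrixOp v (star A) := by
  simp only [matrixOp, star_sum, star_smul, ContinuousLinearMap.star_eq_adjoint, adjoint_rankOne,
    Matrix.star_apply]
  exact Finset.sum_comm

end MatrixOperator

theorem embed_eq (a b : ℝ) (N : ℕ) (M : Matrix (Fin N) (Fin N) ℂ) :
    embed a b N M = 1 + matrixOp (chi a b N) (M - 1) := rfl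

theorem embed_mul {a b : ℝ} (hab : a < b) {N : ℕ} (A B : Matrix (Fin N) (Fin N) ℂ) :
    embed a b N (A * B) = embed a b N A * embed a b N B := by
  have e : A * B - 1 = (A - 1) + (B - 1) + (A - 1) * (B - 1) := by noncomm_ring
  rw [embed_eq, embed_eq, embed_eq, e, matrixOp_add, matrixOp_add,
    matrixOp_mul (orthonormal_chi hab N)]
  noncomm_ring

theorem star_embed (a b : ℝ) {N : ℕ} (A : Matrix (Fin N) (Fin N) ℂ) :
    star (embed a b N A) = embed a b N (star A) := by
  rw [embed_eq, embed_eq, star_add, star_one, star_matrixOp, star_sub, star_one]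

theorem embed_one (a b : ℝ) (N : ℕ) : embed a b N 1 = 1 := by
  rw [embed_eq, sub_self]
  simp [matrixOp]

theorem embed_mem_unitary {a b : ℝ} (hab : a < b) {N : ℕ} {A : Matrix (Fin N) (Fin N) ℂ}
    (hA : A ∈ unitary (Matrix (Fin N) (Fin N) ℂ)) :
    embed a b N A ∈ unitary (H a b →L[ℂ] H a b) := by
  constructor
  · rw [star_embed, ← embed_mul hab, hA.1, embed_one]
  · rw [star_embed, ← embed_mul hab, hA.2, embed_one]

/-! ### Integral operators -/

variable {a b : ℝ}

theorem IsIntegralOperator.add {S T : H a b →L[ℂ] H a b} {K K' : ℝ → ℝ → ℂ}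
    (hS : IsIntegralOperator S K) (hT : IsIntegralOperator T K') :
    IsIntegralOperator (S + T) fun x y => K x y + K' x y := by
  intro f
  have h : ((S + T) f : H a b) = S f + T f := rfl
  rw [h]
  filter_upwards [hS f, hT f, Lp.coeFn_add (S f) (T f)] with x h1 h2 h3
  simp only [add_mul]
  refine ⟨h1.1.add h2.1, ?_⟩
  rw [h3, Pi.add_apply, h1.2, h2.2, integral_add h1.1 h2.1]

theorem IsIntegralOperator.smul {S : H a b →L[ℂ] H a b} {K : ℝ → ℝ → ℂ}
    (hS : IsIntegralOperator S K) (z : ℂ) : IsIntegralOperator (z • S) fun x y => z * K x y := by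
  intro f
  have h : ((z • S) f : H a b) = z • S f := rfl
  rw [h]
  filter_upwards [hS f, Lp.coeFn_smul z (S f)] with x h1 h3
  simp only [mul_assoc]
  refine ⟨h1.1.const_mul z, ?_⟩
  rw [h3, Pi.smul_apply, h1.2, integral_const_mul, smul_eq_mul]

theorem IsIntegralOperator.sub {S T : H a b →L[ℂ] H a b} {K K' : ℝ → ℝ → ℂ}
    (hS : IsIntegralOperator S K) (hT : IsIntegralOperator T K') :
    IsIntegralOperator (S - T) fun x y => K x y - K' x y := by
  have := hS.add (hT.smul (-1))
  simpa [sub_eq_add_neg] using this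

theorem isIntegralOperator_zero : IsIntegralOperator (0 : H a b →L[ℂ] H a b) fun _ _ => 0 := by
  intro f
  have h : ((0 : H a b →L[ℂ] H a b) f : H a b) = 0 := rfl
  rw [h]
  filter_upwards [Lp.coeFn_zero ℂ 2 (vol a b)] with x h1
  rw [h1]
  simp

theorem IsIntegralOperator.sum {ι : Type*} (s : Finset ι) {S : ι → H a b →L[ℂ] H a b}
    {K : ι → ℝ → ℝ → ℂ} (h : ∀ i ∈ s, IsIntegralOperator (S i) (K i)) :
    IsIntegralOperator (∑ i ∈ s, S i) fun x y => ∑ i ∈ s, K i x y := by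
  classical
  induction s using Finset.induction_on with
  | empty => simpa using isIntegralOperator_zero
  | insert i s hi ih =>
    simp only [Finset.sum_insert hi]
    exact (h i (Finset.mem_insert_self _ _)).add
      (ih fun j hj => h j (Finset.mem_insert_of_mem hj))

theorem isIntegralOperator_rankOne_chi (N : ℕ) (j k : Fin N) :
    IsIntegralOperator (InnerProductSpace.rankOne ℂ (chi a b N j) (chi a b N k)) fun x y =>
      (√(N / (b - a)) * √(N / (b - a)) : ℝ) * ((cell a b N j).indicator 1 x
        * (cell a b N k).indicator 1 y) := by
  intro f
  set r : ℝ := √(N / (b - a))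
  have hf : Integrable f (vol a b) := (Lp.memLp f).integrable one_le_two
  have hin : inner ℂ (chi a b N k) f = ∫ y, (r : ℂ) * ((cell a b N k).indicator 1 y * f y) ∂(vol a b) := by
    rw [chi, L2.inner_indicatorConstLp_eq_setIntegral_inner, ← integral_indicator measurableSet_Ico]
    refine integral_congr_ae (Eventually.of_forall fun y => ?_)
    by_cases hy : y ∈ cell a b N k
    · simp only [Set.indicator_of_mem hy, RCLike.inner_apply, Complex.conj_ofReal, Pi.one_apply]
      ring
    · simp only [Set.indicator_of_notMem hy, zero_mul, mul_zero]
  have hT : (InnerProductSpace.rankOne ℂ (chi a b N j) (chi a b N k) : H a b →L[ℂ] H a b) f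
      = inner ℂ (chi a b N k) f • chi a b N j := rfl
  have hint : Integrable (fun y => (cell a b N k).indicator (1 : ℝ → ℂ) y * f y) (vol a b) := by
    have : (fun y => (cell a b N k).indicator (1 : ℝ → ℂ) y * f y) = (cell a b N k).indicator f := by
      funext y
      by_cases hy : y ∈ cell a b N k <;> simp [hy]
    rw [this]
    exact hf.indicator measurableSet_Ico
  rw [hT, hin, integral_const_mul]
  filter_upwards [Lp.coeFn_smul ((r : ℂ) * ∫ y, (cell a b N k).indicator 1 y * f y ∂(vol a b))
    (chi a b N j), indicatorConstLp_coeFn (p := 2) (μ := vol a b)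
    (hs := measurableSet_Ico (a := a + (j : ℕ) * mesh a b N) (b := a + ((j : ℕ) + 1) * mesh a b N))
    (hμs := measure_ne_top (vol a b) _) (c := (r : ℂ))] with x h1 h2
  have e : ∀ y, ((r * r : ℝ) : ℂ) * ((cell a b N j).indicator 1 x * (cell a b N k).indicator 1 y) * f y
      = (r * r : ℝ) * (cell a b N j).indicator 1 x * ((cell a b N k).indicator 1 y * f y) :=
    fun y => by ring
  simp only [e]
  refine ⟨hint.const_mul _, ?_⟩
  rw [h1, Pi.smul_apply, chi, h2, integral_const_mul, smul_eq_mul]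
  by_cases hx : x ∈ cell a b N j
  · rw [Set.indicator_of_mem hx, Set.indicator_of_mem hx]
    push_cast [Pi.one_apply]; ring
  · rw [Set.indicator_of_notMem hx, Set.indicator_of_notMem hx]; ring

/-- The kernel of the operator `embed a b N M - 1`. -/
def stepKernel (a b : ℝ) (N : ℕ) (M : Matrix (Fin N) (Fin N) ℂ) (x y : ℝ) : ℂ :=
  ∑ j : Fin N, ∑ k : Fin N, (M - 1) j k * ((√(N / (b - a)) * √(N / (b - a)) : ℝ) *
    ((cell a b N j).indicator 1 x * (cell a b N k).indicator 1 y))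

theorem isIntegralOperator_embed_sub_one (N : ℕ) (M : Matrix (Fin N) (Fin N) ℂ) :
    IsIntegralOperator (embed a b N M - 1) (stepKernel a b N M) := by
  rw [embed_eq, add_sub_cancel_left, matrixOp]
  exact IsIntegralOperator.sum _ fun j _ => IsIntegralOperator.sum _ fun k _ =>
    (isIntegralOperator_rankOne_chi N j k).smul _

/-- The cells are disjoint, so one term survives; the normalization of the indicators contributes
N/(b - a) = 1/Δ. -/
theorem stepKernel_of_mem (hab : a < b) {N : ℕ} (M : Matrix (Fin N) (Fin N) ℂ) {i j : Fin N}
    {x y : ℝ} (hx : x ∈ cell a b N i) (hy : y ∈ cell a b N j) :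
    stepKernel a b N M x y = (M - 1) i j / mesh a b N := by
  have ind : ∀ {z : ℝ} {i k : Fin N}, z ∈ cell a b N i → k ≠ i →
      (cell a b N k).indicator (1 : ℝ → ℂ) z = 0 := by
    intro z i k hz hk
    refine Set.indicator_of_notMem (fun hz' => ?_) _
    rcases lt_or_gt_of_ne hk with h | h
    · exact Set.disjoint_left.1 (cell_disjoint hab h) hz' hz
    · exact Set.disjoint_left.1 (cell_disjoint hab h) hz hz'
  rw [stepKernel, Finset.sum_eq_single i, Finset.sum_eq_single j, Set.indicator_of_mem hx,
    Set.indicator_of_mem hy, Real.mul_self_sqrt (div_nonneg (Nat.cast_nonneg N) (by linarith)), mesh,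
    ← inv_div (N : ℝ) (b - a)]
  · simp only [Pi.one_apply, mul_one]
    push_cast
    rw [div_inv_eq_mul]
  · intro k _ hk; rw [ind hy hk]; ring
  · simp
  · intro k _ hk; simp [ind hx hk]
  · simp

theorem measurable_stepKernel (N : ℕ) (M : Matrix (Fin N) (Fin N) ℂ) :
    Measurable fun z : ℝ × ℝ => stepKernel a b N M z.1 z.2 := by
  unfold stepKernel
  have h : ∀ j : ℕ, Measurable ((cell a b N j).indicator (1 : ℝ → ℂ)) :=
    fun j => measurable_one.indicator measurableSet_Ico
  refine Finset.measurable_sum _ fun j _ => Finset.measurable_sum _ fun k _ => ?_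
  exact ((((h j).comp measurable_fst).mul ((h k).comp measurable_snd)).const_mul _).const_mul _

/-- Schwarz's inequality for integral operators. -/
theorem enorm_sq_le_of_integral {f g : H a b} {K : ℝ → ℝ → ℂ}
    (hK : Measurable fun z : ℝ × ℝ => K z.1 z.2)
    (hg : ∀ᵐ x ∂(vol a b), g x = ∫ y, K x y * f y ∂(vol a b)) :
    ‖g‖ₑ ^ 2 ≤ (∫⁻ x, ∫⁻ y, ‖K x y‖ₑ ^ 2 ∂(vol a b) ∂(vol a b)) * ‖f‖ₑ ^ 2 := by
  have hsq : ∀ f : H a b, ‖f‖ₑ ^ 2 = ∫⁻ x, ‖f x‖ₑ ^ 2 ∂(vol a b) := by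
    intro f
    have := eLpNorm_nnreal_pow_eq_lintegral (μ := vol a b) (f := f) (p := 2) two_ne_zero
    rw [Lp.enorm_def]
    simpa using this
  have hpt : ∀ᵐ x ∂(vol a b), ‖g x‖ₑ ^ 2 ≤ (∫⁻ y, ‖K x y‖ₑ ^ 2 ∂(vol a b)) * ‖f‖ₑ ^ 2 := by
    filter_upwards [hg] with x hx
    have hKx : AEMeasurable (fun y => ‖K x y‖ₑ) (vol a b) :=
      (hK.comp measurable_prodMk_left).enorm.aemeasurable
    have hfm : AEMeasurable (fun y => ‖f y‖ₑ) (vol a b) := (Lp.aestronglyMeasurable f).enorm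
    have h1 : ‖g x‖ₑ ≤ ∫⁻ y, ‖K x y‖ₑ * ‖f y‖ₑ ∂(vol a b) := by
      rw [hx]
      refine (enorm_integral_le_lintegral_enorm _).trans_eq ?_
      simp_rw [enorm_mul]
    -- Schwarz in y for fixed x; the square of the result is integrated over x at the end.
    have h2 := ENNReal.lintegral_mul_le_Lp_mul_Lq (vol a b) Real.HolderConjugate.two_two hKx hfm
    have h3 : ∀ z : ENNReal, (z ^ (1 / 2 : ℝ)) ^ 2 = z := by
      intro z
      rw [← ENNReal.rpow_natCast, ← ENNReal.rpow_mul]; norm_num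
    calc ‖g x‖ₑ ^ 2 ≤ _ := pow_le_pow_left' (h1.trans h2) 2
      _ = _ := by
        rw [mul_pow, h3, h3, hsq f]
        simp_rw [ENNReal.rpow_two]
  rw [hsq g]
  refine (lintegral_mono_ae hpt).trans_eq ?_
  rw [lintegral_mul_const _ ?_]
  exact (hK.enorm.pow_const 2).lintegral_prod_right'

theorem norm_le_of_integral {f g : H a b} {K : ℝ → ℝ → ℂ}
    (hK : Measurable fun z : ℝ × ℝ => K z.1 z.2)
    (hg : ∀ᵐ x ∂(vol a b), g x = ∫ y, K x y * f y ∂(vol a b))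
    (hfin : ∫⁻ x, ∫⁻ y, ‖K x y‖ₑ ^ 2 ∂(vol a b) ∂(vol a b) ≠ ⊤) :
    ‖g‖ ≤ √(∫⁻ x, ∫⁻ y, ‖K x y‖ₑ ^ 2 ∂(vol a b) ∂(vol a b)).toReal * ‖f‖ := by
  have h := enorm_sq_le_of_integral hK hg
  have h' := ENNReal.toReal_mono (ENNReal.mul_ne_top hfin (by simp)) h
  rw [ENNReal.toReal_mul, ENNReal.toReal_pow, ENNReal.toReal_pow, toReal_enorm, toReal_enorm] at h'
  refine le_of_sq_le_sq ?_ (by positivity)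
  rwa [mul_pow, Real.sq_sqrt ENNReal.toReal_nonneg]

theorem lintegral_sq_ne_top {K : ℝ → ℝ → ℂ} {L : ℝ} (hL : ∀ x y, ‖K x y‖ ≤ L) :
    ∫⁻ x, ∫⁻ y, ‖K x y‖ₑ ^ 2 ∂(vol a b) ∂(vol a b) ≠ ⊤ := by
  have h : ∀ x y, ‖K x y‖ₑ ^ 2 ≤ ENNReal.ofReal L ^ 2 := fun x y => by
    gcongr
    rw [← ofReal_norm]
    exact ENNReal.ofReal_le_ofReal (hL x y)
  refine ((lintegral_mono fun x => lintegral_mono fun y => h x y).trans_lt ?_).ne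
  simp only [lintegral_const]
  exact ENNReal.mul_lt_top (ENNReal.mul_lt_top (by simp) (measure_lt_top _ _)) (measure_lt_top _ _)

/-- Bounded measurable kernels define bounded integral operators. -/
theorem exists_isIntegralOperator {K : ℝ → ℝ → ℂ} (hK : Measurable fun z : ℝ × ℝ => K z.1 z.2)
    {L : ℝ} (hL : ∀ x y, ‖K x y‖ ≤ L) : ∃ T : H a b →L[ℂ] H a b, IsIntegralOperator T K := by
  have hint : ∀ (f : H a b) x, Integrable (fun y => K x y * f y) (vol a b) := fun f x =>
    ((Lp.memLp f).integrable one_le_two).bdd_mul (c := L)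
      (hK.comp measurable_prodMk_left).aestronglyMeasurable (Eventually.of_forall (hL x))
  have hmem : ∀ f : H a b, MemLp (fun x => ∫ y, K x y * f y ∂(vol a b)) 2 (vol a b) := by
    intro f
    have hf : Integrable f (vol a b) := (Lp.memLp f).integrable one_le_two
    refine MemLp.of_bound (C := ∫ y, L * ‖f y‖ ∂(vol a b)) ?_ (Eventually.of_forall fun x => ?_)
    · have : StronglyMeasurable fun z : ℝ × ℝ => K z.1 z.2 * f z.2 :=
        hK.stronglyMeasurable.mul ((Lp.stronglyMeasurable f).comp_measurable measurable_snd)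
      exact this.integral_prod_right'.aestronglyMeasurable
    · refine norm_integral_le_of_norm_le (hf.norm.const_mul L) (Eventually.of_forall fun y => ?_)
      rw [norm_mul]
      gcongr
      exact hL x y
  let T₀ : H a b →ₗ[ℂ] H a b :=
    { toFun := fun f => (hmem f).toLp _
      map_add' := by
        intro f g
        refine Lp.ext ?_
        filter_upwards [(hmem (f + g)).coeFn_toLp, (hmem f).coeFn_toLp, (hmem g).coeFn_toLp,
          Lp.coeFn_add ((hmem f).toLp _) ((hmem g).toLp _)] with x h1 h2 h3 h4
        rw [h1, h4, Pi.add_apply, h2, h3, ← integral_add (hint f x) (hint g x)]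
        refine integral_congr_ae ?_
        filter_upwards [Lp.coeFn_add f g] with y hy
        rw [hy, Pi.add_apply, mul_add]
      map_smul' := by
        intro z f
        refine Lp.ext ?_
        filter_upwards [(hmem (z • f)).coeFn_toLp, (hmem f).coeFn_toLp,
          Lp.coeFn_smul z ((hmem f).toLp _)] with x h1 h2 h3
        rw [h1, RingHom.id_apply, h3, Pi.smul_apply, h2, smul_eq_mul, ← integral_const_mul]
        refine integral_congr_ae ?_
        filter_upwards [Lp.coeFn_smul z f] with y hy
        rw [hy, Pi.smul_apply, smul_eq_mul]
        ring }
  have hT₀ : ∀ f, ∀ᵐ x ∂(vol a b), T₀ f x = ∫ y, K x y * f y ∂(vol a b) :=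
    fun f => (hmem f).coeFn_toLp
  refine ⟨T₀.mkContinuous _ fun f => norm_le_of_integral hK (hT₀ f) (lintegral_sq_ne_top hL),
    fun f => ?_⟩
  filter_upwards [hT₀ f] with x hx
  exact ⟨hint f x, hx⟩

/-- The Hilbert-Schmidt norm dominates the operator norm, which reduces norm convergence to L²
convergence of kernels. -/
theorem IsIntegralOperator.norm_le {T : H a b →L[ℂ] H a b} {K : ℝ → ℝ → ℂ}
    (hT : IsIntegralOperator T K) (hK : Measurable fun z : ℝ × ℝ => K z.1 z.2)
    (hfin : ∫⁻ x, ∫⁻ y, ‖K x y‖ₑ ^ 2 ∂(vol a b) ∂(vol a b) ≠ ⊤) :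
    ‖T‖ ≤ √(∫⁻ x, ∫⁻ y, ‖K x y‖ₑ ^ 2 ∂(vol a b) ∂(vol a b)).toReal :=
  T.opNorm_le_bound (Real.sqrt_nonneg _) fun f =>
    norm_le_of_integral hK ((hT f).mono fun _ h => h.2) hfin

/-! ### Regularity of the kernel -/

theorem continuous_kernelLower (a b : ℝ) (ν : ℂ) :
    Continuous fun z : ℝ × ℝ => kernelLower a b ν z.1 z.2 := by
  have h : Continuous fun z : ℝ × ℝ => ((z.2 - a) * ‖ν‖, (b - z.1) * ‖ν‖) := by fun_prop
  exact ((continuous_of_lipOnBox lipOnBox_besselB_zero).comp h).const_mul ν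

theorem continuous_kernelUpper (a b : ℝ) (ν : ℂ) :
    Continuous fun z : ℝ × ℝ => kernelUpper a b ν z.1 z.2 := by
  have h₁ : Continuous fun z : ℝ × ℝ => ((b - a) * ‖ν‖, (z.2 - z.1) * ‖ν‖) := by fun_prop
  have h₂ : Continuous fun z : ℝ × ℝ => ((z.2 - z.1) * ‖ν‖, (b - a) * ‖ν‖) := by fun_prop
  exact ((continuous_kernelLower a b ν).add
    (((continuous_of_lipOnBox fun R => lipOnBox_besselB_succ R 0).comp h₁).const_mul (‖ν‖ : ℂ))).sub
    (((continuous_of_lipOnBox fun R => lipOnBox_besselSum_zero R (norm_phase_le ν)).comp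
      h₂).const_mul (ν + star ν))

theorem measurable_kernel (a b : ℝ) (ν : ℂ) :
    Measurable fun z : ℝ × ℝ => kernel a b ν z.1 z.2 := by
  unfold kernel
  refine Measurable.add ?_ ?_
  · refine Measurable.ite ?_ (continuous_kernelUpper a b ν).measurable measurable_const
    exact (measurableSet_le measurable_const measurable_fst).inter
      ((measurableSet_lt measurable_fst measurable_snd).inter
        (measurableSet_lt measurable_snd measurable_const))
  · refine Measurable.ite ?_ (continuous_kernelLower a b ν).measurable measurable_const
    exact (measurableSet_le measurable_const measurable_snd).inter
      ((measurableSet_lt measurable_snd measurable_fst).inter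
        (measurableSet_lt measurable_fst measurable_const))

/-! ### Convergence of the step kernels -/

variable {a b : ℝ}

theorem mesh_pos (hab : a < b) {N : ℕ} (hN : 1 ≤ N) : 0 < mesh a b N :=
  div_pos (by linarith) (by exact_mod_cast hN)

theorem tendsto_mesh (a b : ℝ) : Tendsto (mesh a b) atTop (𝓝 0) :=
  tendsto_const_div_atTop_nhds_zero_nat (b - a)

theorem exists_mem_cell (hab : a < b) {N : ℕ} (hN : 1 ≤ N) {x : ℝ} (hx : x ∈ Set.Ico a b) :
    ∃ i : Fin N, x ∈ cell a b N i := by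
  have hd := mesh_pos hab hN
  have hmul := mul_mesh a b hN
  have h0 : 0 ≤ (x - a) / mesh a b N := div_nonneg (by linarith [hx.1]) hd.le
  have h1 := Nat.floor_le h0
  have h2 := Nat.lt_floor_add_one ((x - a) / mesh a b N)
  rw [le_div_iff₀ hd] at h1
  rw [div_lt_iff₀ hd] at h2
  refine ⟨⟨⌊(x - a) / mesh a b N⌋₊, ?_⟩, by simp only; linarith, by simp only; linarith⟩
  rw [Nat.floor_lt h0, div_lt_iff₀ hd, hmul]
  linarith [hx.2]

/-- On the cell with index `(i, j)`, `i ≠ j`, the step kernel is close to the kernel at the corner;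
on the diagonal cells it is bounded. -/
theorem ApproximatesKernel.stepKernel {ν : ℂ} {M : (N : ℕ) → Matrix (Fin N) (Fin N) ℂ}
    (hM : ApproximatesKernel a b ν M) (hab : a < b) :
    ∃ K, 0 ≤ K ∧ ∀ N : ℕ, 1 ≤ N → ∀ (i j : Fin N) (x y : ℝ), x ∈ cell a b N i → y ∈ cell a b N j →
      (i ≠ j → ‖stepKernel a b N (M N) x y - kernel a b ν (a + (i : ℕ) * mesh a b N)
        (a + (j : ℕ) * mesh a b N)‖ ≤ K * mesh a b N) ∧
      (i = j → ‖stepKernel a b N (M N) x y‖ ≤ K) := by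
  obtain ⟨K, hK0, hK⟩ := hM
  refine ⟨K, hK0, fun N hN i j x y hx hy => ?_⟩
  have hd := mesh_pos hab hN
  have hdC : (mesh a b N : ℂ) ≠ 0 := by exact_mod_cast hd.ne'
  have hdn : ‖(mesh a b N : ℂ)‖ = mesh a b N := by rw [Complex.norm_real, Real.norm_of_nonneg hd.le]
  rw [stepKernel_of_mem hab _ hx hy, Matrix.sub_apply]
  refine ⟨fun hij => ?_, fun hij => ?_⟩
  · have := (hK N hN i j).1 hij
    rw [Matrix.one_apply_ne hij, sub_zero]
    have e : ∀ z w : ℂ, z / mesh a b N - w = (z - mesh a b N * w) / mesh a b N := by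
      intro z w; field_simp
    rw [e, norm_div, hdn, div_le_iff₀ hd]
    exact this.trans_eq (by ring)
  · have := (hK N hN i j).2 hij
    subst hij
    rwa [Matrix.one_apply_eq, norm_div, hdn, div_le_iff₀ hd]

/-- This is the constant dominating function. Diagonal cells are included, since there the entry
minus 1 is O(Δ) and stays bounded after division by Δ. -/
theorem ApproximatesKernel.exists_bound {ν : ℂ} {M : (N : ℕ) → Matrix (Fin N) (Fin N) ℂ}
    (hM : ApproximatesKernel a b ν M) (hab : a < b) :
    ∃ B, ∀ N : ℕ, 1 ≤ N → ∀ x ∈ Set.Ico a b, ∀ y ∈ Set.Ico a b,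
      ‖CausalProduct.stepKernel a b N (M N) x y - kernel a b ν x y‖ ≤ B := by
  obtain ⟨K, hK0, hK⟩ := hM.stepKernel hab
  obtain ⟨L, hL⟩ := exists_kernel_bound a b ν
  have hL0 : 0 ≤ L := (norm_nonneg _).trans (hL 0 0)
  have hT : 0 ≤ b - a := by linarith
  refine ⟨K * (b - a) + L + K + L, fun N hN x hx y hy => ?_⟩
  obtain ⟨i, hi⟩ := exists_mem_cell hab hN hx
  obtain ⟨j, hj⟩ := exists_mem_cell hab hN hy
  refine (norm_sub_le _ _).trans (add_le_add ?_ (hL x y))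
  have h0 : 0 ≤ K * (b - a) := by positivity
  by_cases hij : i = j
  · exact ((hK N hN i j x y hi hj).2 hij).trans (by linarith)
  · have h1 := (hK N hN i j x y hi hj).1 hij
    have h2 := norm_le_norm_add_norm_sub' (CausalProduct.stepKernel a b N (M N) x y)
      (kernel a b ν (a + (i : ℕ) * mesh a b N) (a + (j : ℕ) * mesh a b N))
    have h3 := hL (a + (i : ℕ) * mesh a b N) (a + (j : ℕ) * mesh a b N)
    have h4 : K * mesh a b N ≤ K * (b - a) := by gcongr; exact mesh_le hab hN
    linarith

/-- The lower-left corners of the cells containing (x, y) tend to (x, y), and eventually lie on the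
same side of the diagonal, where the kernel agrees with a continuous function. -/
theorem ApproximatesKernel.tendsto_stepKernel {ν : ℂ} {M : (N : ℕ) → Matrix (Fin N) (Fin N) ℂ}
    (hM : ApproximatesKernel a b ν M) (hab : a < b) {x y : ℝ} (hx : x ∈ Set.Ico a b)
    (hy : y ∈ Set.Ico a b) (hxy : x ≠ y) :
    Tendsto (fun N => CausalProduct.stepKernel a b N (M N) x y) atTop (𝓝 (kernel a b ν x y)) := by
  obtain ⟨K, hK0, hK⟩ := hM.stepKernel hab
  have hd := tendsto_mesh a b
  have corner : ∀ {x : ℝ}, x ∈ Set.Ico a b → ∃ i : ℕ → ℕ,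
      (∀ N, 1 ≤ N → ∃ h : i N < N, x ∈ cell a b N (⟨i N, h⟩ : Fin N)) ∧
      Tendsto (fun N => a + (i N : ℝ) * mesh a b N) atTop (𝓝 x) := by
    intro x hx
    have : ∀ N, ∃ i : ℕ, 1 ≤ N → ∃ h : i < N, x ∈ cell a b N (⟨i, h⟩ : Fin N) := by
      intro N
      by_cases hN : 1 ≤ N
      · obtain ⟨i, hi⟩ := exists_mem_cell hab hN hx
        exact ⟨i, fun _ => ⟨i.2, hi⟩⟩
      · exact ⟨0, fun h => absurd h hN⟩
    choose i hi using this
    refine ⟨i, hi, ?_⟩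
    have hlow : Tendsto (fun N => x - mesh a b N) atTop (𝓝 x) := by
      simpa using (tendsto_const_nhds (x := x)).sub hd
    refine tendsto_of_tendsto_of_tendsto_of_le_of_le' hlow (tendsto_const_nhds (x := x)) ?_ ?_
    · filter_upwards [eventually_ge_atTop 1] with N hN
      obtain ⟨_, h⟩ := hi N hN
      have := h.2
      simp only at this
      linarith
    · filter_upwards [eventually_ge_atTop 1] with N hN
      obtain ⟨_, h⟩ := hi N hN
      exact h.1
  obtain ⟨i, hi, hix⟩ := corner hx
  obtain ⟨j, hj, hjy⟩ := corner hy
  have hpair : Tendsto (fun N => (a + (i N : ℝ) * mesh a b N, a + (j N : ℝ) * mesh a b N)) atTop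
      (𝓝 (x, y)) := hix.prodMk_nhds hjy
  have hker : Tendsto (fun N => kernel a b ν (a + (i N : ℝ) * mesh a b N)
      (a + (j N : ℝ) * mesh a b N)) atTop (𝓝 (kernel a b ν x y)) := by
    have hge : ∀ (k : ℕ) (N : ℕ), a ≤ a + k * mesh a b N := fun k N => by
      have := mul_nonneg (Nat.cast_nonneg (α := ℝ) k) (mesh_nonneg hab N)
      linarith
    rcases lt_or_gt_of_ne hxy with h | h
    · rw [kernel_of_lt ν hx.1 h hy.2]
      refine (((continuous_kernelUpper a b ν).tendsto (x, y)).comp hpair).congr' ?_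
      filter_upwards [hix.eventually_lt hjy h, hjy.eventually_lt_const hy.2] with N h1 h2
      exact (kernel_of_lt ν (hge _ _) h1 h2).symm
    · rw [kernel_of_gt ν hy.1 h hx.2]
      refine (((continuous_kernelLower a b ν).tendsto (x, y)).comp hpair).congr' ?_
      filter_upwards [hjy.eventually_lt hix h, hix.eventually_lt_const hx.2] with N h1 h2
      exact (kernel_of_gt ν (hge _ _) h1 h2).symm
  -- Off the diagonal the two cells are eventually distinct, so the estimate for i ≠ j applies.
  have hne : ∀ᶠ N in atTop, i N ≠ j N := by
    rcases lt_or_gt_of_ne hxy with h | h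
    · filter_upwards [hix.eventually_lt hjy h] with N h1 h2
      rw [h2] at h1; exact lt_irrefl _ h1
    · filter_upwards [hjy.eventually_lt hix h] with N h1 h2
      rw [h2] at h1; exact lt_irrefl _ h1
  have hdiff : Tendsto (fun N => CausalProduct.stepKernel a b N (M N) x y
      - kernel a b ν (a + (i N : ℝ) * mesh a b N) (a + (j N : ℝ) * mesh a b N)) atTop (𝓝 0) := by
    have hKd : Tendsto (fun N => K * mesh a b N) atTop (𝓝 0) := by simpa using hd.const_mul K
    refine squeeze_zero_norm' ?_ hKd
    filter_upwards [eventually_ge_atTop 1, hne] with N hN hij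
    obtain ⟨h1, h1'⟩ := hi N hN
    obtain ⟨h2, h2'⟩ := hj N hN
    exact (hK N hN ⟨i N, h1⟩ ⟨j N, h2⟩ x y h1' h2').1 (by simpa using hij)
  simpa using hdiff.add hker

theorem ae_offDiag (a b : ℝ) : ∀ᵐ z ∂((vol a b).prod (vol a b)),
    z.1 ∈ Set.Ico a b ∧ z.2 ∈ Set.Ico a b ∧ z.1 ≠ z.2 := by
  have h1 : ∀ᵐ z ∂((vol a b).prod (vol a b)), z ∈ Set.Ico a b ×ˢ Set.Ico a b := by
    rw [Measure.prod_restrict]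
    exact ae_restrict_mem (measurableSet_Ico.prod measurableSet_Ico)
  have h2 : ∀ᵐ z ∂((vol a b).prod (vol a b)), z.1 ≠ z.2 := by
    have hm : MeasurableSet {z : ℝ × ℝ | z.1 = z.2} := measurableSet_eq_fun measurable_fst measurable_snd
    have : ((vol a b).prod (vol a b)) {z : ℝ × ℝ | z.1 = z.2} = 0 := by
      rw [Measure.measure_prod_null hm]
      refine Eventually.of_forall fun x => ?_
      have : Prod.mk x ⁻¹' {z : ℝ × ℝ | z.1 = z.2} = {x} := by ext y; simp [eq_comm]
      simp only [this, Pi.zero_apply]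
      simp
    rw [ae_iff]
    simpa using this
  filter_upwards [h1, h2] with z h h'
  exact ⟨h.1, h.2, h'⟩

/-- The operators converge in norm. -/
theorem ApproximatesKernel.tendsto_embed {ν : ℂ} {M : (N : ℕ) → Matrix (Fin N) (Fin N) ℂ}
    (hM : ApproximatesKernel a b ν M) (hab : a < b) {T : H a b →L[ℂ] H a b}
    (hT : IsIntegralOperator T (kernel a b ν)) :
    Tendsto (fun N => embed a b N (M N)) atTop (𝓝 (1 + T)) := by
  obtain ⟨B, hB⟩ := hM.exists_bound hab
  set D : ℕ → ℝ → ℝ → ℂ := fun N x y => CausalProduct.stepKernel a b N (M N) x y - kernel a b ν x y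
  have hDm : ∀ N, Measurable fun z : ℝ × ℝ => D N z.1 z.2 := fun N =>
    (measurable_stepKernel N (M N)).sub (measurable_kernel a b ν)
  have hint : ∀ N, IsIntegralOperator (embed a b N (M N) - 1 - T) (D N) := fun N =>
    (isIntegralOperator_embed_sub_one N (M N)).sub hT
  -- S N is the squared Hilbert-Schmidt norm of the error, possibly infinite for some N but
  -- eventually finite because it tends to 0.
  set S : ℕ → ENNReal := fun N => ∫⁻ x, ∫⁻ y, ‖D N x y‖ₑ ^ 2 ∂(vol a b) ∂(vol a b)
  have hS : Tendsto S atTop (𝓝 0) := by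
    have e : ∀ N, S N = ∫⁻ z, ‖D N z.1 z.2‖ₑ ^ 2 ∂((vol a b).prod (vol a b)) := fun N =>
      (lintegral_prod _ ((hDm N).enorm.pow_const 2).aemeasurable).symm
    simp_rw [funext e]
    have := tendsto_lintegral_filter_of_dominated_convergence (l := atTop)
      (μ := (vol a b).prod (vol a b)) (F := fun N (z : ℝ × ℝ) => ‖D N z.1 z.2‖ₑ ^ 2)
      (f := fun _ => 0) (fun _ => ENNReal.ofReal B ^ 2)
      (Eventually.of_forall fun N => (hDm N).enorm.pow_const 2) ?_ ?_ ?_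
    · simpa using this
    · filter_upwards [eventually_ge_atTop 1] with N hN
      filter_upwards [ae_offDiag a b] with z hz
      gcongr
      rw [← ofReal_norm]
      exact ENNReal.ofReal_le_ofReal (hB N hN _ hz.1 _ hz.2.1)
    · rw [lintegral_const]
      exact (ENNReal.mul_lt_top (by simp) (measure_lt_top _ _)).ne
    · filter_upwards [ae_offDiag a b] with z hz
      have h1 : Tendsto (fun N => D N z.1 z.2) atTop (𝓝 0) := by
        simpa using (hM.tendsto_stepKernel hab hz.1 hz.2.1 hz.2.2).sub_const (kernel a b ν z.1 z.2)
      simpa [Function.comp_def] using (ENNReal.continuous_pow 2).continuousAt.tendsto.comp h1.enorm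
  have hSr : Tendsto (fun N => √(S N).toReal) atTop (𝓝 0) := by
    have h1 := (ENNReal.tendsto_toReal ENNReal.zero_ne_top).comp hS
    simpa [Function.comp_def] using (Real.continuous_sqrt.tendsto _).comp h1
  rw [tendsto_iff_norm_sub_tendsto_zero]
  refine squeeze_zero' (Eventually.of_forall fun _ => norm_nonneg _) ?_ hSr
  filter_upwards [hS.eventually_ne ENNReal.zero_ne_top] with N hN
  rw [← sub_sub]
  exact (hint N).norm_le (hDm N) hN

theorem TendstoWeakly.of_tendsto {T : ℕ → H a b →L[ℂ] H a b} {W : H a b →L[ℂ] H a b}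
    (h : Tendsto T atTop (𝓝 W)) : TendstoWeakly T W := fun _ g =>
  tendsto_const_nhds.inner (((ContinuousLinearMap.apply ℂ (H a b) g).continuous.tendsto W).comp h)

end

end CausalProduct

/-! ### The limit operator and its unitarity -/

theorem theorem5 (a b : ℝ) (hab : a < b) (ν : ℂ) :
    ∃ W : CausalProduct.H a b →L[ℂ] CausalProduct.H a b,
      CausalProduct.TendstoWeakly (CausalProduct.rotationProduct a b ν) W ∧
      CausalProduct.TendstoWeakly (CausalProduct.linearizedProduct a b ν) W ∧
      CausalProduct.IsIntegralOperator (W - 1) (CausalProduct.kernel a b ν) ∧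
      W ∈ unitary (CausalProduct.H a b →L[ℂ] CausalProduct.H a b) := by
  obtain ⟨L, hL⟩ := CausalProduct.exists_kernel_bound a b ν
  obtain ⟨T, hT⟩ := CausalProduct.exists_isIntegralOperator (a := a) (b := b)
    (CausalProduct.measurable_kernel a b ν) hL
  have h₁ := (CausalProduct.approximatesKernel_rotation hab ν).tendsto_embed hab hT
  have h₂ := (CausalProduct.approximatesKernel_linearized hab ν).tendsto_embed hab hT
  refine ⟨1 + T, .of_tendsto h₁, .of_tendsto h₂, by rwa [add_sub_cancel_left], ?_⟩
  -- The unitary group is closed in norm, though not weakly, so the norm limit of the rotation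
  -- products is needed here.
  exact isClosed_unitary.mem_of_tendsto h₁ (Eventually.of_forall fun N =>
    CausalProduct.embed_mem_unitary hab (CausalProduct.orderedProd_rotation_mem_unitary a b ν N))
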